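/- Let $1<p<\infty$ and put $$C_p=\frac{p}{4(p-1)^{1/p}\int_0^1 t^{-1/p}(1-t)^{1/p-1}\,dt}.$$ Let $T>0$, and let $X$ be either $\ell^p(\mathbb{R}^n)$, that is $\mathbb{R}^n$ with the norm $\left(\sum_{j=1}^n|x_j|^p\right)^{1/p}$, or the space $L^p(M,\mu)$ of real-valued $p$-integrable functions on a measure space $(M,\mu)$. Let $W^{1,p}_{\rm per}([0,T],X)$ be the space of all $u\in L^p((0,T),X)$ whose weak derivative $\dot u$ on $(0,T)$ lies in $L^p((0,T),X)$ and whose continuous representative satisfies $u(0)=u(T)$. Then every $u\in W^{1,p}_{\rm per}([0,T],X)$ with $\int_0^T u(t)\,dt=0$ satisfies $$\int_0^T\|u(t)\|_X^p\,dt\le C_p^p\,T^p\int_0^T\|\dot u(t)\|_X^p\,dt .$$ The constant $C_p$ is optimal: for each $T>0$ and each such $X\neq\{0\}$ (that is, $n\ge 1$, respectively there is a measurable $A\subset M$ with $0<\mu(A)<\infty$), if $K\ge 0$ and the inequality holds with $K$ in place of $C_p$ for all $u\in W^{1,p}_{\rm per}([0,T],X)$ with $\int_0^T u(t)\,dt=0$,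 then $C_p\le K$. -/

import Mathlib

open MeasureTheory Set
open scoped ENNReal

noncomputable section

/-- The constant
`C_p = p / (4 (p-1)^{1/p} ∫₀¹ t^{-1/p} (1-t)^{1/p-1} dt)`. -/
def wirtingerConst (p : ℝ) : ℝ :=
  p / (4 * (p - 1) ^ (1 / p) * ∫ t in (0 : ℝ)..1, t ^ (-1 / p) * (1 - t) ^ (1 / p - 1))

/-- `v` is a weak (distributional) derivative of `u` on the open interval `(0,T)`: both are locally
Bochner integrable there, and `∫ φ' u = - ∫ φ v` for every real test function `φ`, smooth with
compact support contained in `(0,T)`. -/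
structure HasWeakDeriv {X : Type*} [NormedAddCommGroup X] [NormedSpace ℝ X]
    (T : ℝ) (u v : ℝ → X) : Prop where
  locInt : LocallyIntegrableOn u (Ioo 0 T)
  locInt_deriv : LocallyIntegrableOn v (Ioo 0 T)
  integral_eq : ∀ φ : ℝ → ℝ, ContDiff ℝ ((⊤ : ℕ∞) : WithTop ℕ∞) φ → HasCompactSupport φ →
    tsupport φ ⊆ Ioo 0 T →
    ∫ t in (0 : ℝ)..T, deriv φ t • u t = -∫ t in (0 : ℝ)..T, φ t • v t

/-- `u` belongs to `W^{1,p}_per([0,T], X)` and `v` is its weak derivative: `u` and `v` lie in the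
Bochner space `L^p((0,T), X)`, `v` is the weak derivative of `u`, and the continuous representative
`w` of `u` takes the same value at the two endpoints. -/
structure MemW1pPer {X : Type*} [NormedAddCommGroup X] [NormedSpace ℝ X]
    (p : ℝ≥0∞) (T : ℝ) (u v : ℝ → X) : Prop where
  memLp : MemLp u p (volume.restrict (Ioo 0 T))
  memLp_deriv : MemLp v p (volume.restrict (Ioo 0 T))
  weakDeriv : HasWeakDeriv T u v
  periodic : ∃ w : ℝ → X, ContinuousOn w (Icc 0 T) ∧
    w =ᵐ[volume.restrict (Ioo 0 T)] u ∧ w 0 = w T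

/-- The Wirtinger inequality `∫₀ᵀ ‖u‖^p ≤ K^p T^p ∫₀ᵀ ‖u̇‖^p` with constant `K`, for all
`u ∈ W^{1,p}_per([0,T], X)` of zero mean. -/
def WirtingerInequality (X : Type*) [NormedAddCommGroup X] [NormedSpace ℝ X]
    (p : ℝ≥0∞) (T K : ℝ) : Prop :=
  ∀ u v : ℝ → X, MemW1pPer p T u v → ∫ t in (0 : ℝ)..T, u t = 0 →
    ∫ t in (0 : ℝ)..T, ‖u t‖ ^ p.toReal ≤
      K ^ p.toReal * T ^ p.toReal * ∫ t in (0 : ℝ)..T, ‖v t‖ ^ p.toReal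

end

/-!
Write `L = ∫₀¹ (1 - s^p)^{-1/p} ds` (`quarterPeriod`) and `κ = 4 L / T`. The substitution
`t = 1 - s^p` in the Beta integral gives `C_p^p T^p = 1 / ((p - 1) κ^p)`
(`wirtingerConst_rpow_mul`).

**Scalar inequality.** Let `c` be a `C¹` function with `c(0) = c(T)`, zero mean, maximum `M > 0` and
minimum `-m < 0`. After scaling `c` there is a `ν` such that `f(u) = 1 + ν u - |u|^p` vanishes at both
`M` and `-m` and is nonnegative between them. Young's inequality bounds `|c'| f(c)^{1-1/p} / κ` by
`|c'|^p / (p κ^p) + (1 - 1/p) f(c)`, and the term `ν c` of `f(c)` integrates to zero. Since `c` runs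
twice through `[-m, M]`, the integral of the left side is at least `(2/κ) ∫_{-m}^M f^{1-1/p}`. It
remains to see that this last integral is smallest for `ν = 0`. It is the sum of two contributions, of
`[0, M]` and `[-m, 0]`, with opposite multipliers `ν` and `-ν`, and each is a convex function of its
multiplier: `branchIntegral_tangent` is the tangent inequality at `0`, obtained from the derivative of
the contribution after subtracting a total derivative.

**Vector-valued functions.** By the du Bois-Reymond lemma (`HasWeakDeriv.exists_ae_eq_primitive`) a
periodic Sobolev function of zero mean is the centered primitive of its weak derivative. Centering and
taking primitives are bounded on `L^p((0, T), X)`, where finite sums of continuous scalar functions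
times vectors are dense, so it suffices to treat `∑ cᵢ(t) xᵢ` with smooth scalar functions
(`wirtingerInequality_of_sum_smul`). For these, the scalar inequality is summed over the coordinates
of `ℓ^p`, or integrated over `M`.

**Optimality.** The `p`-sine function `S` solves `|S'|^p = 1 - |S|^p`. Composed with a triangle wave of
period `T` and multiplied by a nonzero vector, it gives equality
(`wirtingerConst_le_of_wirtingerInequality`).
-/

/-! ### The integral of the calibration on one side of zero -/

/-- The length `∫₀¹ (1 - s^p)^{-1/p} ds` of a quarter period of the `p`-sine function. -/
noncomputable def quarterPeriod (p : ℝ) : ℝ :=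
  ∫ s in (0 : ℝ)..1, (1 - s ^ p) ^ (-1 / p)

/-- The function `1 + ν u - u^p` on `[0, x]`, written in the variable `s = u / x ∈ [0, 1]`, when
`ν = x^{p-1} - 1/x` is chosen so that it vanishes at `u = x`. -/
noncomputable def profile (p x s : ℝ) : ℝ := (1 - s) + x ^ p * (s - s ^ p)

/-- The value of the multiplier `ν` for which `1 + ν u - u^p` vanishes at `u = x`. -/
noncomputable def multiplier (p x : ℝ) : ℝ := x ^ (p - 1) - x⁻¹

/-- The integral `∫₀ˣ (1 + ν u - u^p)^{1-1/p} du` with `ν = multiplier p x`, in the variable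
`s = u / x`. -/
noncomputable def branchIntegral (p x : ℝ) : ℝ :=
  ∫ s in (0 : ℝ)..1, x * profile p x s ^ (1 - 1 / p)

section Profile

variable {p : ℝ} (hp : 1 < p)
include hp

theorem rpow_le_self_of_mem_Icc {s : ℝ} (hs : s ∈ Icc (0 : ℝ) 1) : s ^ p ≤ s := by
  have := Real.rpow_le_rpow_of_exponent_ge_of_imp hs.1 hs.2 hp.le (fun _ h => absurd h (by linarith))
  simpa using this

theorem one_sub_le_profile {x s : ℝ} (hx : 0 < x) (hs : s ∈ Icc (0 : ℝ) 1) :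
    1 - s ≤ profile p x s := by
  have h1 := rpow_le_self_of_mem_Icc hp hs
  have h2 : 0 ≤ x ^ p * (s - s ^ p) := mul_nonneg (Real.rpow_nonneg hx.le _) (by linarith)
  unfold profile
  linarith

omit hp in
theorem profile_one (s : ℝ) : profile p 1 s = 1 - s ^ p := by
  simp [profile]

theorem continuous_profile (x : ℝ) : Continuous (profile p x) := by
  unfold profile
  have : Continuous fun s : ℝ => s ^ p := Real.continuous_rpow_const (by linarith)
  fun_prop

omit hp in
theorem neg_one_div_eq : -1 / p = -(1 / p) := by ring

theorem neg_one_lt_neg_inv : -1 < -1 / p := by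
  rw [neg_one_div_eq, neg_lt_neg_iff, div_lt_one (by linarith)]
  exact hp

theorem one_sub_inv_pos : 0 < 1 - 1 / p := by
  have := neg_one_lt_neg_inv hp
  rw [neg_one_div_eq] at this
  linarith

theorem intervalIntegrable_one_sub_rpow :
    IntervalIntegrable (fun s : ℝ => (1 - s) ^ (-1 / p)) volume 0 1 := by
  have h := (intervalIntegral.intervalIntegrable_rpow' (a := 0) (b := 1)
    (neg_one_lt_neg_inv hp)).comp_sub_left 1
  simpa using h.symm

theorem profile_rpow_le {x s : ℝ} (hx : 0 < x) (hs : s ∈ Ioo (0 : ℝ) 1) :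
    profile p x s ^ (-1 / p) ≤ (1 - s) ^ (-1 / p) :=
  Real.rpow_le_rpow_of_nonpos (by linarith [hs.2]) (one_sub_le_profile hp hx ⟨hs.1.le, hs.2.le⟩)
    (by rw [neg_one_div_eq]; have : 0 < 1 / p := by positivity
        linarith)

theorem profile_pos {x s : ℝ} (hx : 0 < x) (hs : s ∈ Ioo (0 : ℝ) 1) : 0 < profile p x s :=
  lt_of_lt_of_le (by linarith [hs.2]) (one_sub_le_profile hp hx ⟨hs.1.le, hs.2.le⟩)

theorem profile_nonneg {x s : ℝ} (hx : 0 < x) (hs : s ∈ Icc (0 : ℝ) 1) : 0 ≤ profile p x s :=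
  le_trans (by linarith [hs.2]) (one_sub_le_profile hp hx hs)

/-- Functions with a singularity at `1` no worse than that of `(1 - s)^{-1/p}` are integrable. -/
theorem intervalIntegrable_of_le_one_sub_rpow {f : ℝ → ℝ} (hf : Measurable f) (C : ℝ)
    (h : ∀ s ∈ Ioo (0 : ℝ) 1, |f s| ≤ C * (1 - s) ^ (-1 / p)) :
    IntervalIntegrable f volume 0 1 := by
  refine ((intervalIntegrable_one_sub_rpow hp).const_mul C).mono_fun' hf.aestronglyMeasurable ?_
  rw [uIoc_of_le zero_le_one, ← restrict_Ioo_eq_restrict_Ioc]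
  exact (ae_restrict_iff' measurableSet_Ioo).2 (ae_of_all _ h)

theorem intervalIntegrable_mul_profile_rpow {g : ℝ → ℝ} (hg : Continuous g) {x : ℝ} (hx : 0 < x) :
    IntervalIntegrable (fun s => g s * profile p x s ^ (-1 / p)) volume 0 1 := by
  obtain ⟨C, hC⟩ := (isCompact_Icc (a := (0 : ℝ)) (b := 1)).exists_bound_of_continuousOn
    hg.continuousOn
  refine intervalIntegrable_of_le_one_sub_rpow hp
    (hg.measurable.mul ((continuous_profile hp x).measurable.pow_const _)) C fun s hs => ?_
  rw [abs_mul, abs_of_nonneg (Real.rpow_nonneg (profile_pos hp hx hs).le _)]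
  exact mul_le_mul (hC s ⟨hs.1.le, hs.2.le⟩) (profile_rpow_le hp hx hs)
    (Real.rpow_nonneg (profile_pos hp hx hs).le _)
    ((abs_nonneg _).trans (hC s ⟨hs.1.le, hs.2.le⟩))

theorem quarterPeriod_pos : 0 < quarterPeriod p := by
  have hi : IntervalIntegrable (fun s : ℝ => (1 - s ^ p) ^ (-1 / p)) volume 0 1 := by
    simpa [profile_one] using intervalIntegrable_mul_profile_rpow hp (g := fun _ => 1)
      continuous_const one_pos
  refine intervalIntegral.intervalIntegral_pos_of_pos_on hi (fun s hs => ?_) one_pos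
  have := profile_pos hp one_pos hs
  rw [profile_one] at this
  positivity

/-- The substitution `t = 1 - s^p` identifies the Beta integral in the definition of
`wirtingerConst` with `p` times the quarter period. -/
theorem integral_beta_eq :
    ∫ t in (0 : ℝ)..1, t ^ (-1 / p) * (1 - t) ^ (1 / p - 1) = p * quarterPeriod p := by
  have himg : (fun s : ℝ => 1 - s ^ p) '' Ioo 0 1 = Ioo 0 1 := by
    ext t
    constructor
    · rintro ⟨s, hs, rfl⟩
      have h1 := Real.rpow_lt_one hs.1.le hs.2 (by linarith : 0 < p)
      have h2 := Real.rpow_pos_of_pos hs.1 p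
      constructor <;> simp only <;> linarith
    · intro ht
      have h0 : 0 < 1 - t := by linarith [ht.2]
      refine ⟨(1 - t) ^ (1 / p), ⟨Real.rpow_pos_of_pos h0 _,
        Real.rpow_lt_one h0.le (by linarith [ht.1]) (by positivity)⟩, ?_⟩
      simp only
      rw [← Real.rpow_mul h0.le, one_div_mul_cancel (by linarith), Real.rpow_one]
      ring
  have h := integral_image_eq_integral_abs_deriv_smul (s := Ioo (0 : ℝ) 1)
    (f := fun s => 1 - s ^ p) (f' := fun s => -(p * s ^ (p - 1))) measurableSet_Ioo
    (fun s hs => by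
      have := (Real.hasDerivAt_rpow_const (x := s) (p := p) (Or.inl hs.1.ne')).const_sub 1
      exact this.hasDerivWithinAt)
    (fun a ha b hb hab => by
      have h1 : a ^ p = b ^ p := by simpa using hab
      exact (Real.rpow_left_inj ha.1.le hb.1.le (by linarith)).1 h1)
    (fun t => t ^ (-1 / p) * (1 - t) ^ (1 / p - 1))
  rw [himg] at h
  rw [quarterPeriod, ← intervalIntegral.integral_const_mul,
    intervalIntegral.integral_of_le zero_le_one, intervalIntegral.integral_of_le zero_le_one,
    ← restrict_Ioo_eq_restrict_Ioc, h]
  refine setIntegral_congr_fun measurableSet_Ioo fun s hs => ?_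
  have hs0 := hs.1
  have e1 : (1 - (1 - s ^ p)) ^ (1 / p - 1) = s ^ (1 - p) := by
    rw [sub_sub_cancel, ← Real.rpow_mul hs0.le]
    congr 1
    field_simp
  have e2 : s ^ (p - 1) * s ^ (1 - p) = 1 := by
    rw [← Real.rpow_add hs0]
    simp
  simp only [smul_eq_mul, abs_neg]
  rw [abs_of_nonneg (by positivity), e1]
  linear_combination (p * (1 - s ^ p) ^ (-1 / p)) * e2

/-- A total derivative in `s`, which integrates to zero over `[0, 1]`. -/
theorem integral_deriv_mul_profile_rpow_eq_zero {x : ℝ} (hx : 0 < x) :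
    ∫ s in (0 : ℝ)..1, (profile p x s + s * ((1 - 1 / p) * (-1 + x ^ p * (1 - p * s ^ (p - 1))))) *
      profile p x s ^ (-1 / p) = 0 := by
  have hr := one_sub_inv_pos hp
  have hc : Continuous fun s : ℝ => s ^ (p - 1) := Real.continuous_rpow_const (by linarith)
  have hcp := continuous_profile hp x
  have hF : Continuous fun s => s * profile p x s ^ (1 - 1 / p) :=
    continuous_id.mul (hcp.rpow_const fun _ => Or.inr hr.le)
  rw [intervalIntegral.integral_eq_sub_of_hasDerivAt_of_le zero_le_one hF.continuousOn
    (f' := fun s => (profile p x s + s * ((1 - 1 / p) * (-1 + x ^ p * (1 - p * s ^ (p - 1))))) *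
      profile p x s ^ (-1 / p))]
  · have : profile p x 1 = 0 := by simp [profile]
    rw [this, Real.zero_rpow hr.ne']
    ring
  · intro s hs
    have hpos := profile_pos hp hx hs
    have h1 : HasDerivAt (profile p x) (-1 + x ^ p * (1 - p * s ^ (p - 1))) s :=
      ((hasDerivAt_id s).const_sub 1).add
        (((hasDerivAt_id s).sub (Real.hasDerivAt_rpow_const (Or.inl hs.1.ne'))).const_mul _)
    have h2 := (hasDerivAt_id s).mul (h1.rpow_const (p := 1 - 1 / p) (Or.inl hpos.ne'))
    refine h2.congr_deriv ?_
    have e1 : profile p x s ^ (1 - 1 / p) = profile p x s * profile p x s ^ (-1 / p) := by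
      rw [neg_one_div_eq, sub_eq_add_neg, Real.rpow_add hpos, Real.rpow_one]
    have e2 : (1 - 1 / p - 1) = -1 / p := by ring
    rw [e1, e2]
    simp only [id]
    ring
  · exact intervalIntegrable_mul_profile_rpow hp (by fun_prop) hx

/-- The constants of the `p`-sine function: `∫₀¹ (1 - s^p)^{1-1/p} = (1 - 1/p) ∫₀¹ (1 - s^p)^{-1/p}`. -/
theorem branchIntegral_one : branchIntegral p 1 = (1 - 1 / p) * quarterPeriod p := by
  have h := integral_deriv_mul_profile_rpow_eq_zero hp one_pos
  have hi := intervalIntegrable_mul_profile_rpow hp (g := fun _ => 1) continuous_const one_pos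
  have hi2 := intervalIntegrable_mul_profile_rpow hp (continuous_profile hp 1) one_pos
  have e : ∀ s ∈ uIcc (0 : ℝ) 1,
      (profile p 1 s + s * ((1 - 1 / p) * (-1 + 1 ^ p * (1 - p * s ^ (p - 1))))) *
      profile p 1 s ^ (-1 / p) =
      p * (profile p 1 s * profile p 1 s ^ (-1 / p)) -
        (p - 1) * (1 * profile p 1 s ^ (-1 / p)) := by
    intro s hs
    rw [uIcc_of_le zero_le_one] at hs
    have e1 : s * s ^ (p - 1) = s ^ p := by
      rcases hs.1.eq_or_lt with h0 | h0
      · rw [← h0, Real.zero_rpow (by linarith : p ≠ 0)]; simp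
      · rw [← Real.rpow_one_add' h0.le (by linarith)]; congr 1; ring
    have e2 : s * ((1 - 1 / p) * (-1 + 1 ^ p * (1 - p * s ^ (p - 1)))) = - ((p - 1) * s ^ p) := by
      rw [Real.one_rpow, ← e1]
      field_simp
      ring
    rw [e2, profile_one]
    ring
  rw [intervalIntegral.integral_congr e, intervalIntegral.integral_sub (hi2.const_mul _)
    (hi.const_mul _), intervalIntegral.integral_const_mul,
    intervalIntegral.integral_const_mul] at h
  have e3 : branchIntegral p 1 = ∫ s in (0 : ℝ)..1, profile p 1 s * profile p 1 s ^ (-1 / p) := by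
    refine intervalIntegral.integral_congr_Ioo_of_le zero_le_one fun s hs => ?_
    have hpos := profile_pos hp one_pos hs
    simp only [one_mul]
    rw [neg_one_div_eq, sub_eq_add_neg, Real.rpow_add hpos, Real.rpow_one]
  have e4 : quarterPeriod p = ∫ s in (0 : ℝ)..1, 1 * profile p 1 s ^ (-1 / p) := by
    simp [quarterPeriod, profile_one]
  rw [← e3, ← e4] at h
  have hp0 : p ≠ 0 := by linarith
  field_simp
  linear_combination h

/-- Derivative of the branch integral, with the total derivative of
`integral_deriv_mul_profile_rpow_eq_zero` removed from the integrand. -/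
theorem hasDerivAt_branchIntegral {x : ℝ} (hx : 0 < x) :
    HasDerivAt (branchIntegral p)
      ((1 - 1 / p) * (1 + (p - 1) * x ^ p) *
        ∫ s in (0 : ℝ)..1, s * profile p x s ^ (-1 / p)) x := by
  have hr := one_sub_inv_pos hp
  have hp0 : p ≠ 0 := by linarith
  have hcs : Continuous fun s : ℝ => s ^ p := Real.continuous_rpow_const (by linarith)
  have hcs1 : Continuous fun s : ℝ => s ^ (p - 1) := Real.continuous_rpow_const (by linarith)
  have hmeas : ∀ y, Continuous fun s => y * profile p y s ^ (1 - 1 / p) := fun y =>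
    continuous_const.mul ((continuous_profile hp y).rpow_const fun _ => Or.inr hr.le)
  have key := intervalIntegral.hasDerivAt_integral_of_dominated_loc_of_deriv_le
    (μ := volume) (a := (0 : ℝ)) (b := 1) (x₀ := x) (s := Ioo (x / 2) (2 * x))
    (F := fun y s => y * profile p y s ^ (1 - 1 / p))
    (F' := fun y s => (profile p y s + (p - 1) * y ^ p * (s - s ^ p)) * profile p y s ^ (-1 / p))
    (bound := fun s => (1 + (2 * x) ^ p + (p - 1) * (2 * x) ^ p) * (1 - s) ^ (-1 / p))
    (Ioo_mem_nhds (by linarith) (by linarith))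
    (Filter.Eventually.of_forall fun y => (hmeas y).aestronglyMeasurable)
    ((hmeas x).intervalIntegrable _ _)
    ?_ ?_ ((intervalIntegrable_one_sub_rpow hp).const_mul _) ?_
  · refine key.2.congr_deriv ?_
    rw [← sub_eq_zero, ← intervalIntegral.integral_const_mul, ← intervalIntegral.integral_sub key.1
      ((intervalIntegrable_mul_profile_rpow hp (g := fun s => s) continuous_id hx).const_mul _)]
    trans ∫ s in (0 : ℝ)..1,
      (profile p x s + s * ((1 - 1 / p) * (-1 + x ^ p * (1 - p * s ^ (p - 1))))) *
      profile p x s ^ (-1 / p)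
    · refine intervalIntegral.integral_congr_Ioo_of_le zero_le_one fun s hs => ?_
      have e1 : s ^ p = s * s ^ (p - 1) := by
        rw [← Real.rpow_one_add' hs.1.le (by linarith)]; congr 1; ring
      rw [e1]
      field_simp
      ring
    · exact integral_deriv_mul_profile_rpow_eq_zero hp hx
  · have := continuous_profile hp x
    refine Measurable.aestronglyMeasurable (Measurable.mul ?_ (this.measurable.pow_const _))
    fun_prop
  -- at `s = 1` the profile vanishes, so this endpoint is left out
  · refine (Measure.ae_ne volume 1).mono fun s hs1 hs y hy => ?_
    rw [uIoc_of_le zero_le_one] at hs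
    have hs' : s ∈ Ioo (0 : ℝ) 1 := ⟨hs.1, lt_of_le_of_ne hs.2 hs1⟩
    have hy0 : 0 < y := by linarith [hy.1]
    have hyp : y ^ p ≤ (2 * x) ^ p := Real.rpow_le_rpow hy0.le hy.2.le (by linarith)
    have h0 : 0 ≤ s - s ^ p := sub_nonneg.2 (rpow_le_self_of_mem_Icc hp ⟨hs.1.le, hs.2⟩)
    have h1 : s - s ^ p ≤ 1 := by have := Real.rpow_nonneg hs.1.le p; linarith [hs.2]
    have hy1 : 0 ≤ y ^ p := by positivity
    have hb : y ^ p * (s - s ^ p) ≤ (2 * x) ^ p := by nlinarith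
    have hpos := profile_pos hp hy0 hs'
    rw [Real.norm_of_nonneg (mul_nonneg (add_nonneg hpos.le (mul_nonneg (mul_nonneg (by linarith)
      hy1) h0)) (Real.rpow_nonneg hpos.le _))]
    refine mul_le_mul ?_ (profile_rpow_le hp hy0 hs') (Real.rpow_nonneg hpos.le _) (by
      have : 0 ≤ p - 1 := by linarith
      positivity)
    have h3 : (p - 1) * (y ^ p * (s - s ^ p)) ≤ (p - 1) * (2 * x) ^ p :=
      mul_le_mul_of_nonneg_left hb (by linarith)
    unfold profile
    linarith [hs.1]
  · refine (Measure.ae_ne volume 1).mono fun s hs1 hs y hy => ?_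
    rw [uIoc_of_le zero_le_one] at hs
    have hs' : s ∈ Ioo (0 : ℝ) 1 := ⟨hs.1, lt_of_le_of_ne hs.2 hs1⟩
    have hy0 : 0 < y := by linarith [hy.1]
    have hpos := profile_pos hp hy0 hs'
    have h1 : HasDerivAt (fun y => profile p y s) (p * y ^ (p - 1) * (s - s ^ p)) y :=
      ((Real.hasDerivAt_rpow_const (Or.inl hy0.ne')).mul_const _).const_add _
    have h2 := (hasDerivAt_id y).mul (h1.rpow_const (p := 1 - 1 / p) (Or.inl hpos.ne'))
    refine h2.congr_deriv ?_
    have e1 : profile p y s ^ (1 - 1 / p) = profile p y s * profile p y s ^ (-1 / p) := by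
      rw [neg_one_div_eq, sub_eq_add_neg, Real.rpow_add hpos, Real.rpow_one]
    have e2 : (1 - 1 / p - 1) = -1 / p := by ring
    have e3 : y ^ p = y * y ^ (p - 1) := by
      rw [← Real.rpow_one_add' hy0.le (by linarith)]; congr 1; ring
    rw [e1, e2, e3]
    simp only [id]
    field_simp

omit hp in
theorem hasDerivAt_multiplier {x : ℝ} (hx : 0 < x) :
    HasDerivAt (multiplier p) ((1 + (p - 1) * x ^ p) * (x ^ 2)⁻¹) x := by
  have h := (Real.hasDerivAt_rpow_const (x := x) (p := p - 1) (Or.inl hx.ne')).sub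
    (hasDerivAt_inv hx.ne')
  refine h.congr_deriv ?_
  have e : x ^ p = x ^ (p - 1 - 1) * x ^ 2 := by
    rw [← Real.rpow_natCast, ← Real.rpow_add hx]; congr 1; push_cast; ring
  rw [e]
  field_simp
  ring

/-- The slope at `x = 1` of the branch integral as a function of the multiplier. -/
noncomputable def branchSlope (p : ℝ) : ℝ :=
  (1 - 1 / p) * ∫ s in (0 : ℝ)..1, s * profile p 1 s ^ (-1 / p)

/-- The branch integral is a convex function of the multiplier, so it lies above its tangent at
`x = 1`, where the multiplier vanishes. Convexity holds because `x² · profile p x s ^ (-1/p)` is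
increasing in `x`. -/
theorem branchIntegral_tangent {x : ℝ} (hx : 0 < x) :
    branchIntegral p 1 + branchSlope p * multiplier p x ≤ branchIntegral p x := by
  have hr := one_sub_inv_pos hp
  set W : ℝ → ℝ := fun y => branchIntegral p y - branchSlope p * multiplier p y with hW
  set W' : ℝ → ℝ := fun y => (1 - 1 / p) * (1 + (p - 1) * y ^ p) * (y ^ 2)⁻¹ *
    ((y ^ 2 * ∫ s in (0 : ℝ)..1, s * profile p y s ^ (-1 / p)) -
      ∫ s in (0 : ℝ)..1, s * profile p 1 s ^ (-1 / p)) with hW'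
  have hd : ∀ y, 0 < y → HasDerivAt W (W' y) y := fun y hy => by
    refine ((hasDerivAt_branchIntegral hp hy).sub
      ((hasDerivAt_multiplier hy).const_mul _)).congr_deriv ?_
    simp only [hW', branchSlope]
    field_simp
  have hfac : ∀ y, 0 < y → 0 ≤ (1 - 1 / p) * (1 + (p - 1) * y ^ p) * (y ^ 2)⁻¹ := fun y hy => by
    have : 0 ≤ p - 1 := by linarith
    have := hr.le
    positivity
  have hpow : ∀ y, 0 < y → ∀ s ∈ Ioo (0 : ℝ) 1,
      y * profile p y s ^ (-1 / p) = (y ^ (-p) * (1 - s) + (s - s ^ p)) ^ (-1 / p) := by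
    intro y hy s hs
    have e : y ^ (-p) * (1 - s) + (s - s ^ p) = y ^ (-p) * profile p y s := by
      have : y ^ (-p) * y ^ p = 1 := by rw [← Real.rpow_add hy]; simp
      unfold profile
      linear_combination -(s - s ^ p) * this
    rw [e, Real.mul_rpow (Real.rpow_nonneg hy.le _) (profile_pos hp hy hs).le, ← Real.rpow_mul hy.le]
    have : -p * (-1 / p) = 1 := by field_simp
    rw [this, Real.rpow_one]
  have hneg : -1 / p ≤ 0 := by
    rw [neg_one_div_eq]; have : 0 < 1 / p := by positivity
    linarith
  have hint : ∀ y, 0 < y → IntervalIntegrable (fun s => s * profile p y s ^ (-1 / p)) volume 0 1 :=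
    fun y hy => intervalIntegrable_mul_profile_rpow hp continuous_id hy
  have hbase : ∀ y, 0 < y → ∀ s ∈ Ioo (0 : ℝ) 1, 0 < y ^ (-p) * (1 - s) + (s - s ^ p) := by
    intro y hy s hs
    have h0 : 0 ≤ s - s ^ p := sub_nonneg.2 (rpow_le_self_of_mem_Icc hp ⟨hs.1.le, hs.2.le⟩)
    have : 0 < 1 - s := by linarith [hs.2]
    positivity
  have hup : ∀ y, 1 ≤ y → 0 ≤ W' y := by
    intro y hy
    have hy0 : 0 < y := by linarith
    refine mul_nonneg (hfac y hy0) (sub_nonneg.2 ?_)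
    rw [← intervalIntegral.integral_const_mul]
    refine intervalIntegral.integral_mono_on_of_le_Ioo zero_le_one (hint 1 one_pos)
      ((hint y hy0).const_mul _) fun s hs => ?_
    have h1 : 1 * profile p 1 s ^ (-1 / p) ≤ y * profile p y s ^ (-1 / p) := by
      rw [hpow 1 one_pos s hs, hpow y hy0 s hs]
      refine Real.rpow_le_rpow_of_nonpos (hbase y hy0 s hs) ?_ hneg
      have : y ^ (-p) ≤ 1 ^ (-p) := Real.rpow_le_rpow_of_nonpos one_pos hy (by linarith)
      nlinarith [hs.2]
    have h2 := Real.rpow_nonneg (profile_pos hp one_pos hs).le (-1 / p)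
    have : profile p 1 s ^ (-1 / p) ≤ y ^ 2 * profile p y s ^ (-1 / p) := by nlinarith
    nlinarith [hs.1]
  have hdown : ∀ y, 0 < y → y ≤ 1 → W' y ≤ 0 := by
    intro y hy0 hy
    refine mul_nonpos_of_nonneg_of_nonpos (hfac y hy0) (sub_nonpos.2 ?_)
    rw [← intervalIntegral.integral_const_mul]
    refine intervalIntegral.integral_mono_on_of_le_Ioo zero_le_one ((hint y hy0).const_mul _)
      (hint 1 one_pos) fun s hs => ?_
    have h1 : y * profile p y s ^ (-1 / p) ≤ 1 * profile p 1 s ^ (-1 / p) := by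
      rw [hpow 1 one_pos s hs, hpow y hy0 s hs]
      refine Real.rpow_le_rpow_of_nonpos (hbase 1 one_pos s hs) ?_ hneg
      have : 1 ^ (-p) ≤ y ^ (-p) := Real.rpow_le_rpow_of_nonpos hy0 hy (by linarith)
      nlinarith [hs.2]
    have h2 := Real.rpow_nonneg (profile_pos hp hy0 hs).le (-1 / p)
    have h3 : y ^ 2 * profile p y s ^ (-1 / p) ≤ y * profile p y s ^ (-1 / p) :=
      mul_le_mul_of_nonneg_right (by nlinarith) h2
    nlinarith [hs.1]
  have hW1 : W 1 = branchIntegral p 1 := by simp [hW, multiplier]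
  suffices W 1 ≤ W x by
    rw [hW1] at this
    simp only [hW] at this
    linarith
  rcases le_total 1 x with h | h
  · refine monotoneOn_of_deriv_nonneg (convex_Icc 1 x)
      (fun y hy => (hd y (by linarith [hy.1])).continuousAt.continuousWithinAt)
      (fun y hy => ?_) (fun y hy => ?_) (left_mem_Icc.2 h) (right_mem_Icc.2 h) h
    all_goals rw [interior_Icc] at hy
    · exact (hd y (by linarith [hy.1])).differentiableAt.differentiableWithinAt
    · rw [(hd y (by linarith [hy.1])).deriv]
      exact hup y hy.1.le
  · refine antitoneOn_of_deriv_nonpos (convex_Icc x 1)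
      (fun y hy => (hd y (by linarith [hy.1])).continuousAt.continuousWithinAt)
      (fun y hy => ?_) (fun y hy => ?_) (left_mem_Icc.2 h) (right_mem_Icc.2 h) h
    all_goals rw [interior_Icc] at hy
    · exact (hd y (by linarith [hy.1])).differentiableAt.differentiableWithinAt
    · rw [(hd y (by linarith [hy.1])).deriv]
      exact hdown y (by linarith [hy.1]) hy.2.le

end Profile

/-! ### The sharp scalar inequality -/

section ScalarInequality

theorem wirtingerConst_rpow_mul {p T : ℝ} (hp : 1 < p) (hT : 0 < T) :
    wirtingerConst p ^ p * T ^ p = ((p - 1) * (4 * quarterPeriod p / T) ^ p)⁻¹ := by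
  have hL := quarterPeriod_pos hp
  have hp1 : 0 < p - 1 := by linarith
  have hC : wirtingerConst p = ((p - 1) ^ (1 / p) * (4 * quarterPeriod p))⁻¹ := by
    rw [wirtingerConst, integral_beta_eq hp]
    have : p ≠ 0 := by linarith
    have := (Real.rpow_pos_of_pos hp1 (1 / p)).ne'
    field_simp
  have h1 : ((p - 1) ^ (1 / p)) ^ p = p - 1 := by
    rw [← Real.rpow_mul hp1.le, one_div_mul_cancel (by linarith), Real.rpow_one]
  rw [hC, Real.inv_rpow (by positivity), Real.mul_rpow (by positivity) (by positivity), h1,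
    Real.div_rpow (by positivity) hT.le]
  have := (Real.rpow_pos_of_pos hT p).ne'
  have := (Real.rpow_pos_of_pos (show 0 < 4 * quarterPeriod p by positivity) p).ne'
  field_simp

/-- A periodic function passes twice between any two of its values. -/
theorem two_mul_sub_le_integral_abs_deriv {T : ℝ} {h h' : ℝ → ℝ} (hd : ∀ t, HasDerivAt h (h' t) t)
    (hc : Continuous h') (hper : h 0 = h T) {a b : ℝ} (ha : a ∈ Icc 0 T) (hb : b ∈ Icc 0 T) :
    2 * (h b - h a) ≤ ∫ t in (0 : ℝ)..T, |h' t| := by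
  have hi : ∀ x y, IntervalIntegrable (fun t => |h' t|) volume x y := fun x y =>
    hc.abs.intervalIntegrable x y
  have key : ∀ x y, x ≤ y → |h y - h x| ≤ ∫ t in x..y, |h' t| := fun x y hxy => by
    rw [← intervalIntegral.integral_eq_sub_of_hasDerivAt (fun t _ => hd t)
      (hc.intervalIntegrable x y)]
    exact intervalIntegral.abs_integral_le_integral_abs hxy
  wlog hab : a ≤ b generalizing a b h h'
  · have := this (h := fun t => -h t) (h' := fun t => -h' t) (fun t => (hd t).neg) hc.neg
      (by simp [hper]) hb ha (by simpa using hi)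
      (fun x y hxy => by rw [neg_sub_neg, abs_sub_comm]; simpa using key x y hxy)
      (le_of_not_ge hab)
    simp only [abs_neg] at this
    linarith
  have h1 := key 0 a ha.1
  have h2 := key a b hab
  have h3 := key b T hb.2
  rw [← intervalIntegral.integral_add_adjacent_intervals (hi 0 a) (hi a T),
    ← intervalIntegral.integral_add_adjacent_intervals (hi a b) (hi b T)]
  have e1 := neg_abs_le (h a - h 0)
  have e2 := le_abs_self (h b - h a)
  have e3 := neg_abs_le (h T - h b)
  linarith

/-- `multiplier p` is the function of `x` for which `1 + ν (s x) - (s x)^p` is `profile p x s`. -/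
theorem profile_eq {p x s : ℝ} (hx : 0 < x) (hs : 0 ≤ s) :
    1 + multiplier p x * (x * s) - (x * s) ^ p = profile p x s := by
  have e : x ^ (p - 1) * x = x ^ p := by
    rw [← Real.rpow_add_one hx.ne']; congr 1; ring
  rw [multiplier, profile, Real.mul_rpow hx.le hs]
  have : x⁻¹ * x = 1 := inv_mul_cancel₀ hx.ne'
  linear_combination s * e - s * this

/-- The sharp scalar inequality, for a function scaled so that its maximum `M` and minimum `-m`
have opposite multipliers. The calibration is `(1 + ν u - |u|^p)^{1-1/p}`, where the linear term
integrates to zero along a function of zero mean. -/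
theorem integral_abs_rpow_le_of_multiplier {p T : ℝ} (hp : 1 < p) (hT : 0 < T) {c c' : ℝ → ℝ}
    (hd : ∀ t, HasDerivAt c (c' t) t) (hc' : Continuous c') (hper : c 0 = c T)
    (hmean : ∫ t in (0 : ℝ)..T, c t = 0) {m M a b : ℝ} (hm : 0 < m) (hM : 0 < M)
    (ha : a ∈ Icc 0 T) (hb : b ∈ Icc 0 T) (hca : c a = -m) (hcb : c b = M)
    (hbd : ∀ t ∈ Icc 0 T, c t ∈ Icc (-m) M) (hmM : multiplier p M + multiplier p m = 0) :
    ∫ t in (0 : ℝ)..T, |c t| ^ p ≤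
      ((p - 1) * (4 * quarterPeriod p / T) ^ p)⁻¹ * ∫ t in (0 : ℝ)..T, |c' t| ^ p := by
  have hp0 : 0 < p := by linarith
  have hr := one_sub_inv_pos hp
  set κ := 4 * quarterPeriod p / T with hκ
  have hκ0 : 0 < κ := by have := quarterPeriod_pos hp; positivity
  set ν := multiplier p M with hν
  set f : ℝ → ℝ := fun u => max (1 + ν * u - |u| ^ p) 0 with hf
  have hcc : Continuous c := continuous_iff_continuousAt.2 fun t => (hd t).continuousAt
  have habs : Continuous fun u : ℝ => |u| ^ p := continuous_abs.rpow_const fun _ => Or.inr hp0.le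
  have hfc : Continuous f := by fun_prop
  have hf0 : ∀ u, 0 ≤ f u := fun u => le_max_right _ _
  -- the calibration on the two sides of zero
  have hfM : ∀ s ∈ Icc (0 : ℝ) 1, 1 + ν * (M * s) - |M * s| ^ p = profile p M s := fun s hs => by
    rw [abs_of_nonneg (mul_nonneg hM.le hs.1), profile_eq hM hs.1]
  have hfm : ∀ s ∈ Icc (0 : ℝ) 1, 1 + ν * (-(m * s)) - |-(m * s)| ^ p = profile p m s :=
    fun s hs => by
      rw [abs_neg, abs_of_nonneg (mul_nonneg hm.le hs.1), ← profile_eq hm hs.1]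
      linear_combination (-(m * s)) * hmM
  have hfpos : ∀ u ∈ Icc (-m) M, 0 ≤ 1 + ν * u - |u| ^ p := by
    intro u hu
    rcases le_total 0 u with h | h
    · have hs : u / M ∈ Icc (0 : ℝ) 1 := ⟨by positivity, (div_le_one hM).2 hu.2⟩
      have := hfM _ hs
      rw [mul_div_cancel₀ _ hM.ne'] at this
      rw [this]
      exact profile_nonneg hp hM hs
    · have hs : -u / m ∈ Icc (0 : ℝ) 1 :=
        ⟨div_nonneg (by linarith) hm.le, (div_le_one hm).2 (by linarith [hu.1])⟩
      have := hfm _ hs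
      rw [mul_div_cancel₀ _ hm.ne', neg_neg] at this
      rw [this]
      exact profile_nonneg hp hm hs
  have hbc : Continuous fun u => f u ^ (1 - 1 / p) := hfc.rpow_const fun _ => Or.inr hr.le
  have hbcc : Continuous fun t => f (c t) ^ (1 - 1 / p) * c' t := (hbc.comp hcc).mul hc'
  -- oscillation of the primitive of the calibration
  have hosc := two_mul_sub_le_integral_abs_deriv (T := T)
    (h := fun t => ∫ u in (0 : ℝ)..c t, f u ^ (1 - 1 / p))
    (h' := fun t => f (c t) ^ (1 - 1 / p) * c' t)
    (fun t => by
      have h1 := intervalIntegral.integral_hasDerivAt_right (hbc.intervalIntegrable 0 (c t))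
        (hbc.stronglyMeasurableAtFilter _ _) hbc.continuousAt
      exact h1.comp t (hd t))
    hbcc (by simp only [hper]) ha hb
  have hM' : ∫ u in (0 : ℝ)..M, f u ^ (1 - 1 / p) = branchIntegral p M := by
    have h1 := intervalIntegral.mul_integral_comp_mul_left (a := 0) (b := 1) (c := M)
      (f := fun u => f u ^ (1 - 1 / p))
    rw [mul_zero, mul_one, ← intervalIntegral.integral_const_mul] at h1
    rw [← h1, branchIntegral]
    refine intervalIntegral.integral_congr fun s hs => ?_
    rw [uIcc_of_le zero_le_one] at hs
    simp only [hf]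
    rw [hfM s hs, max_eq_left (profile_nonneg hp hM hs)]
  have hm' : ∫ u in (0 : ℝ)..(-m), f u ^ (1 - 1 / p) = - branchIntegral p m := by
    have h1 := intervalIntegral.mul_integral_comp_mul_left (a := 0) (b := 1) (c := -m)
      (f := fun u => f u ^ (1 - 1 / p))
    rw [mul_zero, mul_one, neg_mul, ← intervalIntegral.integral_const_mul] at h1
    rw [← h1, branchIntegral, neg_inj]
    refine intervalIntegral.integral_congr fun s hs => ?_
    rw [uIcc_of_le zero_le_one] at hs
    simp only [hf, neg_mul]
    have := hfm s hs
    rw [mul_neg, abs_neg] at this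
    rw [mul_neg, abs_neg, this, max_eq_left (profile_nonneg hp hm hs)]
  simp only [hca, hcb, hM', hm', sub_neg_eq_add] at hosc
  have htM := branchIntegral_tangent hp hM
  have htm := branchIntegral_tangent hp hm
  have hsum : 2 * branchIntegral p 1 ≤ branchIntegral p M + branchIntegral p m := by
    rw [← hν] at htM
    linear_combination htM + htm - (branchSlope p) * hmM
  rw [branchIntegral_one hp] at hsum
  -- Young's inequality along the curve
  have hyoung : ∀ t ∈ Icc 0 T, |f (c t) ^ (1 - 1 / p) * c' t| ≤
      κ * ((κ ^ p)⁻¹ / p * |c' t| ^ p + (1 - 1 / p) * (1 + ν * c t - |c t| ^ p)) := by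
    intro t ht
    have hq : p.HolderConjugate (p / (p - 1)) := Real.HolderConjugate.conjExponent hp
    have h1 := Real.young_inequality_of_nonneg (a := |c' t| / κ) (b := f (c t) ^ (1 - 1 / p))
      (by positivity) (Real.rpow_nonneg (hf0 _) _) hq
    have e1 : (f (c t) ^ (1 - 1 / p)) ^ (p / (p - 1)) = 1 + ν * c t - |c t| ^ p := by
      rw [← Real.rpow_mul (hf0 _)]
      have : (1 - 1 / p) * (p / (p - 1)) = 1 := by
        have : p - 1 ≠ 0 := by linarith
        field_simp
      rw [this, Real.rpow_one]
      exact max_eq_left (hfpos _ (hbd t ht))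
    rw [e1, Real.div_rpow (abs_nonneg _) hκ0.le] at h1
    rw [abs_mul, abs_of_nonneg (Real.rpow_nonneg (hf0 _) _)]
    have h2 := mul_le_mul_of_nonneg_left h1 hκ0.le
    have e2 : κ * (|c' t| / κ * f (c t) ^ (1 - 1 / p)) = f (c t) ^ (1 - 1 / p) * |c' t| := by
      field_simp
    rw [e2] at h2
    refine h2.trans (le_of_eq ?_)
    have : p - 1 ≠ 0 := by linarith
    field_simp
  have hicp : Continuous fun t => |c t| ^ p := habs.comp hcc
  have hicp' : Continuous fun t => |c' t| ^ p := habs.comp hc'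
  have hint := intervalIntegral.integral_mono_on hT.le (hbcc.abs.intervalIntegrable (μ := volume) 0 T)
    (Continuous.intervalIntegrable (by fun_prop) 0 T) hyoung
  have hev : ∫ t in (0 : ℝ)..T,
      κ * ((κ ^ p)⁻¹ / p * |c' t| ^ p + (1 - 1 / p) * (1 + ν * c t - |c t| ^ p)) =
      κ * ((κ ^ p)⁻¹ / p * (∫ t in (0 : ℝ)..T, |c' t| ^ p) +
        (1 - 1 / p) * (T - ∫ t in (0 : ℝ)..T, |c t| ^ p)) := by
    rw [intervalIntegral.integral_const_mul, intervalIntegral.integral_add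
      (Continuous.intervalIntegrable (by fun_prop) 0 T)
      (Continuous.intervalIntegrable (by fun_prop) 0 T), intervalIntegral.integral_const_mul,
      intervalIntegral.integral_const_mul, intervalIntegral.integral_sub
      (Continuous.intervalIntegrable (by fun_prop) 0 T)
      (Continuous.intervalIntegrable (by fun_prop) 0 T), intervalIntegral.integral_add
      (Continuous.intervalIntegrable (by fun_prop) 0 T)
      (Continuous.intervalIntegrable (by fun_prop) 0 T), intervalIntegral.integral_const_mul,
      hmean]
    simp
  rw [hev] at hint
  have hfin : κ * ((1 - 1 / p) * T) ≤ κ * ((κ ^ p)⁻¹ / p * (∫ t in (0 : ℝ)..T, |c' t| ^ p) +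
        (1 - 1 / p) * (T - ∫ t in (0 : ℝ)..T, |c t| ^ p)) := by
    refine le_trans ?_ (hosc.trans hint)
    have : κ * T = 4 * quarterPeriod p := by rw [hκ]; field_simp
    nlinarith
  have h2 := le_of_mul_le_mul_left hfin hκ0
  have h3 : (1 - 1 / p) * (∫ t in (0 : ℝ)..T, |c t| ^ p) ≤
      (κ ^ p)⁻¹ / p * (∫ t in (0 : ℝ)..T, |c' t| ^ p) := by linarith
  have hp1 : 0 < p - 1 := by linarith
  rw [← mul_le_mul_iff_right₀ hr]
  refine h3.trans (le_of_eq ?_)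
  field_simp

/-- The sharp scalar inequality for continuously differentiable functions. -/
theorem integral_abs_rpow_le_of_hasDerivAt {p T : ℝ} (hp : 1 < p) (hT : 0 < T) {c c' : ℝ → ℝ}
    (hd : ∀ t, HasDerivAt c (c' t) t) (hc' : Continuous c') (hper : c 0 = c T)
    (hmean : ∫ t in (0 : ℝ)..T, c t = 0) :
    ∫ t in (0 : ℝ)..T, |c t| ^ p ≤
      ((p - 1) * (4 * quarterPeriod p / T) ^ p)⁻¹ * ∫ t in (0 : ℝ)..T, |c' t| ^ p := by
  have hp0 : 0 < p := by linarith
  have hp1 : 0 < p - 1 := by linarith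
  have hL := quarterPeriod_pos hp
  have hcc : Continuous c := continuous_iff_continuousAt.2 fun t => (hd t).continuousAt
  obtain ⟨a, ha, hamin⟩ := isCompact_Icc.exists_isMinOn (nonempty_Icc.2 hT.le) hcc.continuousOn
  obtain ⟨b, hb, hbmax⟩ := isCompact_Icc.exists_isMaxOn (nonempty_Icc.2 hT.le) hcc.continuousOn
  by_cases hzero : ∀ t ∈ Icc 0 T, c t = 0
  · have : ∫ t in (0 : ℝ)..T, |c t| ^ p = ∫ t in (0 : ℝ)..T, (0 : ℝ) := by
      refine intervalIntegral.integral_congr fun t ht => ?_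
      rw [uIcc_of_le hT.le] at ht
      simp [hzero t ht, hp0.ne']
    rw [this, intervalIntegral.integral_zero]
    exact mul_nonneg (by positivity) (intervalIntegral.integral_nonneg hT.le fun t _ => by positivity)
  -- a nonzero function of zero mean takes both signs
  have hsign : ∀ g : ℝ → ℝ, Continuous g → (∫ t in (0 : ℝ)..T, g t = 0) →
      (∀ t ∈ Icc 0 T, 0 ≤ g t) → ∀ t ∈ Icc 0 T, g t = 0 := by
    intro g hg hg0 hgn t ht
    by_contra hne
    have := intervalIntegral.integral_pos hT hg.continuousOn
      (fun t ht => hgn t ⟨ht.1.le, ht.2⟩) ⟨t, ht, lt_of_le_of_ne (hgn t ht) (Ne.symm hne)⟩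
    linarith
  have hca : c a < 0 := by
    by_contra hcon
    exact hzero (hsign c hcc hmean fun t ht => (not_lt.1 hcon).trans (hamin ht))
  have hcb : 0 < c b := by
    by_contra hcon
    refine hzero fun t ht => neg_eq_zero.1 (hsign (fun t => -c t) hcc.neg (by simp [hmean])
      (fun t ht => neg_nonneg.2 ((hbmax ht).trans (not_lt.1 hcon))) t ht)
  -- the scaling factor `d` solves `multiplier p (c b / d) + multiplier p (-c a / d) = 0`
  have hnca : 0 < -c a := by linarith
  set A := (c b) ^ (p - 1) + (-c a) ^ (p - 1) with hA
  set B := (c b)⁻¹ + (-c a)⁻¹ with hB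
  have hA0 : 0 < A := by positivity
  have hB0 : 0 < B := by positivity
  set d := (A / B) ^ (1 / p) with hd_def
  have hd0 : 0 < d := by positivity
  have hdp : d ^ p = A / B := by
    rw [hd_def, ← Real.rpow_mul (by positivity), one_div_mul_cancel hp0.ne', Real.rpow_one]
  have hdp1 : d ^ (p - 1) = A / B / d := by
    rw [Real.rpow_sub_one hd0.ne', hdp]
  have key := integral_abs_rpow_le_of_multiplier hp hT (c := fun t => d⁻¹ * c t)
    (c' := fun t => d⁻¹ * c' t) (fun t => (hd t).const_mul _) (by fun_prop) (by simp only [hper])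
    (by rw [intervalIntegral.integral_const_mul, hmean, mul_zero]) (m := d⁻¹ * (-c a))
    (M := d⁻¹ * c b) (by positivity) (by positivity) ha hb (by ring) rfl
    (fun t ht => ⟨by
      rw [← mul_neg, neg_neg]
      exact mul_le_mul_of_nonneg_left (hamin ht) (by positivity),
      mul_le_mul_of_nonneg_left (hbmax ht) (by positivity)⟩)
    (by
      unfold multiplier
      rw [Real.mul_rpow (by positivity) hcb.le, Real.mul_rpow (by positivity) hnca.le,
        Real.inv_rpow hd0.le, hdp1, mul_inv, mul_inv, inv_inv]
      have : (A / B / d)⁻¹ * A = d * B := by field_simp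
      linear_combination this)
  have hscale : ∀ g : ℝ → ℝ, ∫ t in (0 : ℝ)..T, |d⁻¹ * g t| ^ p =
      (d⁻¹) ^ p * ∫ t in (0 : ℝ)..T, |g t| ^ p := fun g => by
    rw [← intervalIntegral.integral_const_mul]
    refine intervalIntegral.integral_congr fun t _ => ?_
    rw [abs_mul, Real.mul_rpow (abs_nonneg _) (abs_nonneg _), abs_of_pos (inv_pos.2 hd0)]
  rw [hscale, hscale, mul_left_comm] at key
  exact le_of_mul_le_mul_left key (by positivity)

end ScalarInequality

/-! ### Functions with a weak derivative are primitives -/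

section WeakDerivative

variable {E : Type*} [NormedAddCommGroup E] [NormedSpace ℝ E]

theorem integral_Ioo_eq_intervalIntegral {T : ℝ} (hT : 0 ≤ T) (f : ℝ → E) :
    ∫ t in Ioo 0 T, f t = ∫ t in (0 : ℝ)..T, f t := by
  rw [intervalIntegral.integral_of_le hT, restrict_Ioo_eq_restrict_Ioc]

omit [NormedSpace ℝ E] in
theorem intervalIntegrable_of_integrable_Ioo {T : ℝ} (hT : 0 ≤ T) {f : ℝ → E}
    (hf : Integrable f (volume.restrict (Ioo 0 T))) : IntervalIntegrable f volume 0 T := by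
  rw [intervalIntegrable_iff_integrableOn_Ioc_of_le hT, IntegrableOn,
    ← restrict_Ioo_eq_restrict_Ioc]
  exact hf

omit [NormedSpace ℝ E] in
theorem intervalIntegrable_of_mem_Icc {T : ℝ} {f : ℝ → E} (hf : IntervalIntegrable f volume 0 T)
    {a b : ℝ} (ha : a ∈ Icc 0 T) (hb : b ∈ Icc 0 T) : IntervalIntegrable f volume a b := by
  refine hf.mono_set ?_
  rw [uIcc_of_le (ha.1.trans ha.2)]
  exact uIcc_subset_Icc ha hb

theorem continuousOn_primitive_Icc {T : ℝ} (hT : 0 ≤ T) {f : ℝ → E}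
    (hf : IntervalIntegrable f volume 0 T) :
    ContinuousOn (fun t => ∫ s in (0 : ℝ)..t, f s) (Icc 0 T) := by
  have := intervalIntegral.continuousOn_primitive_interval' hf left_mem_uIcc
  rwa [uIcc_of_le hT] at this

/-- Integration by parts against a test function, for the primitive of an integrable function. -/
theorem integral_deriv_smul_primitive [CompleteSpace E] {T : ℝ} (hT : 0 ≤ T) {v : ℝ → E}
    (hv : Integrable v (volume.restrict (Ioo 0 T))) {φ : ℝ → ℝ} (hφ : ContDiff ℝ 1 φ)
    (hφT : φ T = 0) :
    ∫ t in (0 : ℝ)..T, deriv φ t • ∫ s in (0 : ℝ)..t, v s = -∫ t in (0 : ℝ)..T, φ t • v t := by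
  have hφ' : Continuous (deriv φ) := hφ.continuous_deriv le_rfl
  have hvi := intervalIntegrable_of_integrable_Ioo hT hv
  have hφi : Integrable (deriv φ) (volume.restrict (Ioo 0 T)) :=
    (hφ'.integrableOn_Icc (a := 0) (b := T)).mono_set Ioo_subset_Icc_self
  set F : ℝ → ℝ → E := fun t s => {x : ℝ × ℝ | x.2 < x.1}.indicator
    (fun x => deriv φ x.1 • v x.2) (t, s) with hF
  have hint : Integrable (Function.uncurry F)
      ((volume.restrict (Ioo 0 T)).prod (volume.restrict (Ioo 0 T))) :=
    (hφi.smul_prod hv).indicator (measurableSet_lt measurable_snd measurable_fst)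
  have h1 : ∀ t ∈ Ioo 0 T, deriv φ t • ∫ s in (0 : ℝ)..t, v s = ∫ s in Ioo 0 T, F t s := by
    intro t ht
    have e : ∀ s, F t s = (Iio t).indicator (fun s => deriv φ t • v s) s := fun s => by
      simp [hF, indicator]
    simp_rw [e]
    rw [setIntegral_indicator measurableSet_Iio, integral_smul,
      ← integral_Ioo_eq_intervalIntegral ht.1.le]
    congr 3
    ext s
    exact ⟨fun h => ⟨⟨h.1, h.2.trans ht.2⟩, h.2⟩, fun h => ⟨h.1.1, h.2⟩⟩
  have h2 : ∀ s ∈ Ioo 0 T, ∫ t in Ioo 0 T, F t s = -(φ s • v s) := by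
    intro s hs
    have e : ∀ t, F t s = (Ioi s).indicator (fun t => deriv φ t • v s) t := fun t => by
      simp [hF, indicator]
    simp_rw [e]
    rw [setIntegral_indicator measurableSet_Ioi, integral_smul_const]
    have : Ioo 0 T ∩ Ioi s = Ioo s T := by
      ext t
      exact ⟨fun h => ⟨h.2, h.1.2⟩, fun h => ⟨⟨hs.1.trans h.1, h.2⟩, h.1⟩⟩
    rw [this, restrict_Ioo_eq_restrict_Ioc, ← intervalIntegral.integral_of_le hs.2.le,
      intervalIntegral.integral_deriv_eq_sub (fun t _ => hφ.differentiable one_ne_zero t)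
        (hφ'.intervalIntegrable _ _), hφT, zero_sub, neg_smul]
  rw [← integral_Ioo_eq_intervalIntegral hT, ← integral_Ioo_eq_intervalIntegral hT,
    setIntegral_congr_fun measurableSet_Ioo h1, integral_integral_swap hint,
    setIntegral_congr_fun measurableSet_Ioo h2, integral_neg]

/-- The primitive of a test function of zero integral is a test function. -/
theorem exists_test_primitive {T : ℝ} (hT : 0 < T) {ψ : ℝ → ℝ}
    (hψ : ContDiff ℝ ((⊤ : ℕ∞) : WithTop ℕ∞) ψ) (hc : HasCompactSupport ψ)
    (hs : tsupport ψ ⊆ Ioo 0 T) (h0 : ∫ t in (0 : ℝ)..T, ψ t = 0) :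
    ∃ φ : ℝ → ℝ, ContDiff ℝ ((⊤ : ℕ∞) : WithTop ℕ∞) φ ∧ HasCompactSupport φ ∧
      tsupport φ ⊆ Ioo 0 T ∧ deriv φ = ψ := by
  have hψc := hψ.continuous
  obtain ⟨α, β, hα, hβ, hsub⟩ : ∃ α β, 0 < α ∧ β < T ∧ tsupport ψ ⊆ Icc α β := by
    rcases (tsupport ψ).eq_empty_or_nonempty with he | hne
    · exact ⟨T / 2, T / 2, by linarith, by linarith, by simp [he]⟩
    · exact ⟨sInf (tsupport ψ), sSup (tsupport ψ), (hs (hc.isCompact.sInf_mem hne)).1,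
        (hs (hc.isCompact.sSup_mem hne)).2,
        fun x hx => ⟨csInf_le hc.isCompact.bddBelow hx, le_csSup hc.isCompact.bddAbove hx⟩⟩
  have hz : ∀ t, t ∉ Icc α β → ψ t = 0 := fun t ht => image_eq_zero_of_notMem_tsupport
    fun h => ht (hsub h)
  have hd : ∀ t, HasDerivAt (fun t => ∫ s in (0 : ℝ)..t, ψ s) (ψ t) t := fun t =>
    intervalIntegral.integral_hasDerivAt_right (hψc.intervalIntegrable _ _)
      (hψc.stronglyMeasurableAtFilter _ _) hψc.continuousAt
  have hderiv : deriv (fun t => ∫ s in (0 : ℝ)..t, ψ s) = ψ := funext fun t => (hd t).deriv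
  have hout : ∀ t, t ∉ Icc α β → ∫ s in (0 : ℝ)..t, ψ s = 0 := by
    intro t ht
    rcases lt_or_ge t α with h | h
    · refine (intervalIntegral.integral_congr fun s hs' => ?_).trans
        intervalIntegral.integral_zero
      refine hz s fun hmem => ?_
      rcases le_total 0 t with h' | h'
      · rw [uIcc_of_le h'] at hs'; linarith [hs'.2, hmem.1]
      · rw [uIcc_of_ge h'] at hs'; linarith [hs'.2, hmem.1]
    · have hβt : β < t := by
        by_contra hcon
        exact ht ⟨h, not_lt.1 hcon⟩
      rw [← intervalIntegral.integral_add_adjacent_intervals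
        (hψc.intervalIntegrable 0 T) (hψc.intervalIntegrable T t), h0, zero_add]
      refine (intervalIntegral.integral_congr fun s hs' => ?_).trans
        intervalIntegral.integral_zero
      refine hz s fun hmem => ?_
      rcases le_total T t with h' | h'
      · rw [uIcc_of_le h'] at hs'; linarith [hs'.1, hmem.2]
      · rw [uIcc_of_ge h'] at hs'; linarith [hs'.1, hmem.2]
  have hts : tsupport (fun t => ∫ s in (0 : ℝ)..t, ψ s) ⊆ Icc α β :=
    closure_minimal (fun t ht => by
      by_contra hcon
      exact ht (hout t hcon)) isClosed_Icc
  refine ⟨fun t => ∫ s in (0 : ℝ)..t, ψ s, ?_, ?_, fun t ht => ?_, hderiv⟩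
  · rw [contDiff_infty_iff_deriv, hderiv]
    exact ⟨fun t => (hd t).differentiableAt, hψ⟩
  · exact isCompact_Icc.of_isClosed_subset (isClosed_tsupport _) hts
  · exact ⟨hα.trans_le (hts ht).1, (hts ht).2.trans_lt hβ⟩

variable [CompleteSpace E]

/-- The du Bois-Reymond lemma: a function with a weak derivative is a primitive of it. -/
theorem HasWeakDeriv.exists_ae_eq_primitive {T : ℝ} (hT : 0 < T) {u v : ℝ → E}
    (h : HasWeakDeriv T u v) (hu : Integrable u (volume.restrict (Ioo 0 T)))
    (hv : Integrable v (volume.restrict (Ioo 0 T))) :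
    ∃ a : E, ∀ᵐ t ∂volume.restrict (Ioo 0 T), u t = a + ∫ s in (0 : ℝ)..t, v s := by
  set V : ℝ → E := fun t => ∫ s in (0 : ℝ)..t, v s with hV
  have hvi := intervalIntegrable_of_integrable_Ioo hT.le hv
  have hVi : Integrable V (volume.restrict (Ioo 0 T)) :=
    ((continuousOn_primitive_Icc hT.le hvi).integrableOn_Icc).mono_set Ioo_subset_Icc_self
  -- a test function `η` with unit integral
  obtain ⟨η, hηc, hηs, hηT, hη1⟩ : ∃ η : ℝ → ℝ, ContDiff ℝ ((⊤ : ℕ∞) : WithTop ℕ∞) η ∧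
      HasCompactSupport η ∧ tsupport η ⊆ Ioo 0 T ∧ ∫ t in (0 : ℝ)..T, η t = 1 := by
    obtain ⟨f, hf1, hf2, hf3, hf4, hf5⟩ := exists_contDiff_tsupport_subset (n := ⊤)
      (Ioo_mem_nhds (a := 0) (b := T) (x := T / 2) (by linarith) (by linarith))
    have hpos : 0 < ∫ t in (0 : ℝ)..T, f t :=
      intervalIntegral.integral_pos hT hf3.continuous.continuousOn
        (fun t _ => (hf4 (mem_range_self t)).1) ⟨T / 2, ⟨by linarith, by linarith⟩, by simp [hf5]⟩
    refine ⟨fun t => (∫ t in (0 : ℝ)..T, f t)⁻¹ * f t, contDiff_const.mul hf3, hf2.mul_left,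
      (tsupport_mul_subset_right (f := fun _ => (∫ t in (0 : ℝ)..T, f t)⁻¹)).trans hf1, ?_⟩
    rw [intervalIntegral.integral_const_mul, inv_mul_cancel₀ hpos.ne']
  have hsm : ∀ (ψ : ℝ → ℝ), Continuous ψ → ∀ z : ℝ → E,
      Integrable z (volume.restrict (Ioo 0 T)) → IntervalIntegrable (fun t => ψ t • z t) volume 0 T :=
    fun ψ hψ z hz => (intervalIntegrable_of_integrable_Ioo hT.le hz).continuousOn_smul
      hψ.continuousOn
  have hann : ∀ φ : ℝ → ℝ, ContDiff ℝ ((⊤ : ℕ∞) : WithTop ℕ∞) φ → HasCompactSupport φ →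
      tsupport φ ⊆ Ioo 0 T → ∫ t in (0 : ℝ)..T, deriv φ t • (u t - V t) = 0 := by
    intro φ h1 h2 h3
    have hd : Continuous (deriv φ) := h1.continuous_deriv (by simp)
    have hφT : φ T = 0 := image_eq_zero_of_notMem_tsupport fun h => lt_irrefl _ (h3 h).2
    simp_rw [smul_sub]
    rw [intervalIntegral.integral_sub (hsm _ hd u hu) (hsm _ hd V hVi), h.integral_eq φ h1 h2 h3,
      integral_deriv_smul_primitive hT.le hv (h1.of_le (by simp)) hφT, sub_self]
  set a : E := ∫ t in (0 : ℝ)..T, η t • (u t - V t) with ha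
  refine ⟨a, ?_⟩
  have huVi : Integrable (fun t => u t - V t) (volume.restrict (Ioo 0 T)) := hu.sub hVi
  have hzi : Integrable (fun t => u t - V t - a) (volume.restrict (Ioo 0 T)) :=
    huVi.sub (integrable_const a)
  have key := IsOpen.ae_eq_zero_of_integral_contDiff_smul_eq_zero (μ := volume)
    (f := fun t => u t - V t - a) (U := Ioo 0 T) isOpen_Ioo
    (IntegrableOn.locallyIntegrableOn hzi) ?_
  · refine (ae_restrict_iff' measurableSet_Ioo).2 (key.mono fun t ht htm => ?_)
    have := ht htm
    rw [sub_sub, sub_eq_zero] at this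
    rw [this, add_comm]
  · intro ψ hψ hψc hψs
    have hz0 : ∀ t, t ∉ Ioo 0 T → ψ t • (u t - V t - a) = 0 := fun t ht => by
      rw [image_eq_zero_of_notMem_tsupport fun h => ht (hψs h), zero_smul]
    rw [← setIntegral_eq_integral_of_forall_compl_eq_zero hz0,
      integral_Ioo_eq_intervalIntegral hT.le]
    set m := ∫ t in (0 : ℝ)..T, ψ t with hm
    obtain ⟨φ, h1, h2, h3, h4⟩ := exists_test_primitive hT (ψ := fun t => ψ t - m * η t)
      (hψ.sub (contDiff_const.mul hηc)) (hψc.sub hηs.mul_left)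
      ((tsupport_sub ψ fun t => m * η t).trans (union_subset hψs
        ((tsupport_mul_subset_right (f := fun _ => m)).trans hηT)))
      (by
        have hmη : IntervalIntegrable (fun t => m * η t) volume 0 T :=
          (continuous_const.mul hηc.continuous).intervalIntegrable _ _
        rw [intervalIntegral.integral_sub (hψ.continuous.intervalIntegrable _ _) hmη,
          intervalIntegral.integral_const_mul, hη1, mul_one, sub_self])
    have h5 := hann φ h1 h2 h3
    rw [h4] at h5
    simp_rw [sub_smul, mul_smul] at h5
    have hmη : IntervalIntegrable (fun t => m • η t • (u t - V t)) volume 0 T :=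
      (hsm _ hηc.continuous _ huVi).smul m
    rw [intervalIntegral.integral_sub (hsm _ hψ.continuous _ huVi) hmη, intervalIntegral.integral_smul, ← ha,
      sub_eq_zero] at h5
    simp_rw [smul_sub _ (u _ - V _) a]
    rw [intervalIntegral.integral_sub (hsm _ hψ.continuous _ huVi)
      (hsm _ hψ.continuous _ (integrable_const a)), intervalIntegral.integral_smul_const, h5,
      ← hm, sub_self]

end WeakDerivative

/-! ### Reduction to finite sums of smooth scalar functions -/

section Density

variable {E : Type*} [NormedAddCommGroup E] [NormedSpace ℝ E]

/-- The function `z` on `[0, T]` minus its mean value. -/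
noncomputable def centered (T : ℝ) (z : ℝ → E) (t : ℝ) : E := z t - T⁻¹ • ∫ s in (0 : ℝ)..T, z s

/-- The primitive of `z` that vanishes at `0`. -/
noncomputable def primitive (z : ℝ → E) (t : ℝ) : E := ∫ s in (0 : ℝ)..t, z s

/-- On the bounded interval `(0, T)` the `L^p` norm of `z` controls its `L^1` norm, hence also the
`L^p` norm of every function bounded pointwise by the `L^1` norm of `z`. -/
theorem exists_eLpNorm_le_mul_of_norm_le_integral (E : Type*) [NormedAddCommGroup E]
    {p : ℝ≥0∞} (hp : 1 ≤ p) {T : ℝ} (hT : 0 < T) :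
    ∃ A : ℝ≥0∞, A ≠ ⊤ ∧ ∀ z g : ℝ → E, MemLp z p (volume.restrict (Ioo 0 T)) →
      (∀ t ∈ Ioo 0 T, ‖g t‖ ≤ ∫ s in (0 : ℝ)..T, ‖z s‖) →
      eLpNorm g p (volume.restrict (Ioo 0 T)) ≤ A * eLpNorm z p (volume.restrict (Ioo 0 T)) := by
  set μ := volume.restrict (Ioo 0 T) with hμ
  have hμu : μ univ = ENNReal.ofReal T := by simp [hμ]
  refine ⟨μ univ ^ p.toReal⁻¹ * μ univ ^ (1 / (1 : ℝ≥0∞).toReal - 1 / p.toReal), ?_, ?_⟩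
  · rw [hμu]
    have h0 : ENNReal.ofReal T ≠ 0 := by simpa using hT
    exact ENNReal.mul_ne_top (ENNReal.rpow_ne_top_of_ne_zero h0 ENNReal.ofReal_ne_top)
      (ENNReal.rpow_ne_top_of_ne_zero h0 ENNReal.ofReal_ne_top)
  · intro z g hz hg
    have hzi : Integrable z μ := hz.integrable hp
    have h1 : eLpNorm g p μ ≤ μ univ ^ p.toReal⁻¹ * ENNReal.ofReal (∫ s in (0 : ℝ)..T, ‖z s‖) :=
      eLpNorm_le_of_ae_bound ((ae_restrict_iff' measurableSet_Ioo).2 (ae_of_all _ hg))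
    rw [← integral_Ioo_eq_intervalIntegral hT.le, ofReal_integral_norm_eq_lintegral_enorm hzi,
      ← eLpNorm_one_eq_lintegral_enorm] at h1
    refine h1.trans ?_
    rw [mul_assoc, mul_comm _ (eLpNorm z p μ)]
    gcongr
    exact eLpNorm_le_eLpNorm_mul_rpow_measure_univ hp hz.1

omit [NormedSpace ℝ E] in
theorem memLp_of_continuous {p : ℝ≥0∞} {T : ℝ} {f : ℝ → E} (hf : ContinuousOn f (Icc 0 T)) :
    MemLp f p (volume.restrict (Ioo 0 T)) := by
  obtain ⟨C, hC⟩ := isCompact_Icc.exists_bound_of_continuousOn hf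
  exact MemLp.of_bound ((hf.mono Ioo_subset_Icc_self).aestronglyMeasurable measurableSet_Ioo) C
    ((ae_restrict_iff' measurableSet_Ioo).2 (ae_of_all _ fun t ht => hC t (Ioo_subset_Icc_self ht)))

theorem memLp_primitive {p : ℝ≥0∞} {T : ℝ} (hT : 0 ≤ T) {z : ℝ → E}
    (hz : IntervalIntegrable z volume 0 T) :
    MemLp (primitive z) p (volume.restrict (Ioo 0 T)) :=
  memLp_of_continuous (continuousOn_primitive_Icc hT hz)

theorem memLp_centered {p : ℝ≥0∞} {T : ℝ} {z : ℝ → E}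
    (hz : MemLp z p (volume.restrict (Ioo 0 T))) :
    MemLp (centered T z) p (volume.restrict (Ioo 0 T)) :=
  hz.sub (memLp_const _)

/-- Both `centered` and `primitive` are bounded on `L^p(0, T)`. -/
theorem exists_eLpNorm_centered_primitive_le (E : Type*) [NormedAddCommGroup E] [NormedSpace ℝ E]
    {p : ℝ≥0∞} (hp : 1 ≤ p) {T : ℝ} (hT : 0 < T) :
    ∃ A : ℝ≥0∞, A ≠ ⊤ ∧ ∀ z : ℝ → E, MemLp z p (volume.restrict (Ioo 0 T)) →
      eLpNorm (centered T z) p (volume.restrict (Ioo 0 T)) ≤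
        A * eLpNorm z p (volume.restrict (Ioo 0 T)) ∧
      eLpNorm (primitive z) p (volume.restrict (Ioo 0 T)) ≤
        A * eLpNorm z p (volume.restrict (Ioo 0 T)) := by
  obtain ⟨A, hA, h⟩ := exists_eLpNorm_le_mul_of_norm_le_integral E hp hT
  set μ := volume.restrict (Ioo 0 T) with hμ
  refine ⟨1 + ‖T⁻¹‖ₑ * A + A, by finiteness, fun z hz => ⟨?_, ?_⟩⟩
  · have h1 : eLpNorm (fun _ : ℝ => T⁻¹ • ∫ s in (0 : ℝ)..T, z s) p μ ≤
        ‖T⁻¹‖ₑ * (A * eLpNorm z p μ) := by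
      have := eLpNorm_const_smul (p := p) (μ := μ) T⁻¹ (fun _ : ℝ => ∫ s in (0 : ℝ)..T, z s)
      refine this.le.trans ?_
      gcongr
      exact h z _ hz fun t _ => intervalIntegral.norm_integral_le_integral_norm hT.le
    calc eLpNorm (centered T z) p μ
        ≤ eLpNorm z p μ + eLpNorm (fun _ : ℝ => T⁻¹ • ∫ s in (0 : ℝ)..T, z s) p μ :=
          eLpNorm_sub_le hz.1 aestronglyMeasurable_const hp
      _ ≤ eLpNorm z p μ + ‖T⁻¹‖ₑ * (A * eLpNorm z p μ) := by gcongr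
      _ = (1 + ‖T⁻¹‖ₑ * A) * eLpNorm z p μ := by ring
      _ ≤ (1 + ‖T⁻¹‖ₑ * A + A) * eLpNorm z p μ := mul_le_mul' le_self_add le_rfl
  · refine (h z _ hz fun t ht => ?_).trans (mul_le_mul' le_add_self le_rfl)
    have hzi := (intervalIntegrable_of_integrable_Ioo hT.le (hz.integrable hp)).norm
    refine (intervalIntegral.norm_integral_le_integral_norm ht.1.le).trans ?_
    exact intervalIntegral.integral_mono_interval le_rfl ht.1.le ht.2.le
      (ae_of_all _ fun _ => norm_nonneg _) hzi

omit [NormedSpace ℝ E] in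
theorem integral_norm_rpow_le_iff {p : ℝ≥0∞} (hp1 : 1 < p) (hp : p ≠ ⊤) {T : ℝ} (hT : 0 < T)
    {K : ℝ} (hK : 0 ≤ K) {f g : ℝ → E} (hf : MemLp f p (volume.restrict (Ioo 0 T)))
    (hg : MemLp g p (volume.restrict (Ioo 0 T))) :
    ∫ t in (0 : ℝ)..T, ‖f t‖ ^ p.toReal ≤
        K ^ p.toReal * T ^ p.toReal * ∫ t in (0 : ℝ)..T, ‖g t‖ ^ p.toReal ↔
      eLpNorm f p (volume.restrict (Ioo 0 T)) ≤
        ENNReal.ofReal (K * T) * eLpNorm g p (volume.restrict (Ioo 0 T)) := by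
  have hp0 : p ≠ 0 := (zero_lt_one.trans hp1).ne'
  have hq : 0 < p.toReal := ENNReal.toReal_pos hp0 hp
  have hpos : ∀ z : ℝ → E, 0 ≤ ∫ t in (0 : ℝ)..T, ‖z t‖ ^ p.toReal := fun z =>
    intervalIntegral.integral_nonneg hT.le fun t _ => by positivity
  rw [hf.eLpNorm_eq_integral_rpow_norm hp0 hp, hg.eLpNorm_eq_integral_rpow_norm hp0 hp,
    integral_Ioo_eq_intervalIntegral hT.le, integral_Ioo_eq_intervalIntegral hT.le,
    ← ENNReal.ofReal_mul (by positivity), ENNReal.ofReal_le_ofReal_iff (by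
      have := hpos g
      positivity), ← Real.rpow_le_rpow_iff (z := p.toReal)
      (Real.rpow_nonneg (hpos f) _) (mul_nonneg (by positivity) (Real.rpow_nonneg (hpos g) _)) hq,
    Real.rpow_inv_rpow (hpos f) hq.ne', Real.mul_rpow (by positivity) (Real.rpow_nonneg (hpos g) _),
    Real.rpow_inv_rpow (hpos g) hq.ne', Real.mul_rpow hK hT.le]

theorem continuous_centered {T : ℝ} {z : ℝ → E} (hz : Continuous z) : Continuous (centered T z) :=
  hz.sub continuous_const

theorem continuous_primitive {z : ℝ → E} (hz : Continuous z) : Continuous (primitive z) :=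
  intervalIntegral.continuous_primitive (fun a b => hz.intervalIntegrable a b) 0

variable [CompleteSpace E]

theorem centered_sum {ι : Type*} [Fintype ι] (T : ℝ) {ψ : ι → ℝ → ℝ} (hψ : ∀ i, Continuous (ψ i))
    (x : ι → E) :
    centered T (fun t => ∑ i, ψ i t • x i) = fun t => ∑ i, centered T (ψ i) t • x i := by
  funext t
  have hi : ∀ i ∈ Finset.univ, IntervalIntegrable (fun s => ψ i s • x i) volume 0 T := fun i _ =>
    ((hψ i).smul continuous_const).intervalIntegrable 0 T
  simp only [centered]
  rw [intervalIntegral.integral_finsetSum hi, Finset.smul_sum, ← Finset.sum_sub_distrib]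
  refine Finset.sum_congr rfl fun i _ => ?_
  rw [intervalIntegral.integral_smul_const, sub_smul, smul_assoc]

theorem primitive_sum {ι : Type*} [Fintype ι] {ψ : ι → ℝ → ℝ} (hψ : ∀ i, Continuous (ψ i))
    (x : ι → E) :
    primitive (fun t => ∑ i, ψ i t • x i) = fun t => ∑ i, primitive (ψ i) t • x i := by
  funext t
  have hi : ∀ i ∈ Finset.univ, IntervalIntegrable (fun s => ψ i s • x i) volume 0 t := fun i _ =>
    ((hψ i).smul continuous_const).intervalIntegrable 0 t
  simp only [primitive]
  rw [intervalIntegral.integral_finsetSum hi]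
  exact Finset.sum_congr rfl fun i _ => intervalIntegral.integral_smul_const _ _

theorem integral_centered {T : ℝ} (hT : 0 < T) {z : ℝ → E}
    (hz : IntervalIntegrable z volume 0 T) : ∫ t in (0 : ℝ)..T, centered T z t = 0 := by
  simp only [centered]
  rw [intervalIntegral.integral_sub hz intervalIntegrable_const,
    intervalIntegral.integral_const, smul_smul, sub_zero, mul_inv_cancel₀ hT.ne', one_smul, sub_self]

omit [CompleteSpace E] in
/-- Finite sums of continuous scalar functions times vectors are dense in `L^p((0, T), E)`. -/
theorem exists_sum_smul_eLpNorm_sub_le {p : ℝ≥0∞} (hp : p ≠ ⊤) {T : ℝ} {v : ℝ → E}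
    (hv : MemLp v p (volume.restrict (Ioo 0 T))) {ε : ℝ≥0∞} (hε : ε ≠ 0) :
    ∃ g, eLpNorm (v - g) p (volume.restrict (Ioo 0 T)) ≤ ε ∧
      ∃ (ι : Type) (_ : Fintype ι) (ψ : ι → ℝ → ℝ) (x : ι → E), (∀ i, Continuous (ψ i)) ∧
        g = fun t => ∑ i, ψ i t • x i := by
  refine MemLp.induction_dense hp _ ?_ ?_ ?_ hv hε
  · intro c s hs hsμ ε hε
    obtain ⟨δ, hδ0, hδ⟩ := ENNReal.exists_pos_mul_lt (a := ENNReal.ofReal ‖c‖)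
      ENNReal.ofReal_ne_top hε
    obtain ⟨ψ, -, hψ, hψc, -⟩ := MemLp.exists_hasCompactSupport_eLpNorm_sub_le hp
      (memLp_indicator_const p hs (1 : ℝ) (Or.inr hsμ.ne)) hδ0.ne'
    refine ⟨fun t => ψ t • c, ?_, Unit, inferInstance, fun _ => ψ, fun _ => c, fun _ => hψc, by simp⟩
    rw [eLpNorm_sub_comm] at hψ
    have h1 := eLpNorm_le_mul_eLpNorm_of_ae_le_mul (p := p) (c := ‖c‖)
      (μ := volume.restrict (Ioo 0 T)) (f := (fun t => ψ t • c) - s.indicator fun _ => c)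
      (g := ψ - s.indicator fun _ => (1 : ℝ)) (ae_of_all _ fun t => by
        by_cases ht : t ∈ s
        · have : ψ t • c - c = (ψ t - 1) • c := by rw [sub_smul, one_smul]
          simp [ht, this, norm_smul, mul_comm]
        · simp [ht, norm_smul, mul_comm])
    refine h1.trans (le_trans ?_ hδ.le)
    rw [mul_comm]
    gcongr
  · rintro f g ⟨ι, _, ψ, x, hψ, rfl⟩ ⟨κ, _, η, y, hη, rfl⟩
    refine ⟨ι ⊕ κ, inferInstance, Sum.elim ψ η, Sum.elim x y, ?_, ?_⟩
    · rintro (i | i)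
      exacts [hψ i, hη i]
    · funext t
      simp [Fintype.sum_sum_type]
  · rintro f ⟨ι, _, ψ, x, hψ, rfl⟩
    exact Continuous.aestronglyMeasurable (by fun_prop)

/-- A periodic Sobolev function of zero mean is the centered primitive of its weak derivative, which
itself has zero mean. -/
theorem MemW1pPer.ae_eq_centered_primitive {p : ℝ≥0∞} (hp1 : 1 ≤ p) {T : ℝ} (hT : 0 < T)
    {u v : ℝ → E} (h : MemW1pPer p T u v) (hu0 : ∫ t in (0 : ℝ)..T, u t = 0) :
    ∫ t in (0 : ℝ)..T, v t = 0 ∧ u =ᵐ[volume.restrict (Ioo 0 T)] centered T (primitive v) := by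
  have hvi := h.memLp_deriv.integrable hp1
  have hvi' := intervalIntegrable_of_integrable_Ioo hT.le hvi
  obtain ⟨a, ha⟩ := h.weakDeriv.exists_ae_eq_primitive hT (h.memLp.integrable hp1) hvi
  obtain ⟨w, hwc, hwu, hwT⟩ := h.periodic
  have hVc := continuousOn_primitive_Icc hT.le hvi'
  have heq : EqOn w (fun t => a + ∫ s in (0 : ℝ)..t, v s) (Icc 0 T) := by
    refine Measure.eqOn_Icc_of_ae_eq volume hT.ne ?_ hwc (continuousOn_const.add hVc)
    rw [← Measure.restrict_congr_set Ioo_ae_eq_Icc]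
    exact hwu.trans ha
  constructor
  · have h0 := heq (left_mem_Icc.2 hT.le)
    have h1 := heq (right_mem_Icc.2 hT.le)
    simp only [intervalIntegral.integral_same, add_zero] at h0 h1
    rw [h0, h1] at hwT
    simpa using hwT.symm
  · have hVi : IntervalIntegrable (fun t => ∫ s in (0 : ℝ)..t, v s) volume 0 T :=
      (uIcc_of_le hT.le ▸ hVc : ContinuousOn _ (uIcc 0 T)).intervalIntegrable
    have h2 : T • a + ∫ t in (0 : ℝ)..T, ∫ s in (0 : ℝ)..t, v s = 0 := by
      rw [← hu0, ← integral_Ioo_eq_intervalIntegral hT.le u, integral_congr_ae ha,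
        integral_Ioo_eq_intervalIntegral hT.le,
        intervalIntegral.integral_add intervalIntegrable_const hVi]
      simp
    refine ha.mono fun t ht => ?_
    rw [ht]
    simp only [centered, primitive]
    rw [← neg_eq_of_add_eq_zero_right h2, smul_neg, smul_smul, inv_mul_cancel₀ hT.ne', one_smul]
    abel

/-- It suffices to prove the Wirtinger inequality for functions `∑ i, c i • x i` with finitely many
continuously differentiable periodic scalar functions `c i` of zero mean. -/
theorem wirtingerInequality_of_sum_smul {p : ℝ≥0∞} (hp1 : 1 < p) (hp : p ≠ ⊤) {T : ℝ}
    (hT : 0 < T) {K : ℝ} (hK : 0 ≤ K)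
    (h : ∀ (ι : Type) [Fintype ι] (x : ι → E) (c c' : ι → ℝ → ℝ),
      (∀ i t, HasDerivAt (c i) (c' i t) t) → (∀ i, Continuous (c' i)) →
      (∀ i, c i 0 = c i T) → (∀ i, ∫ t in (0 : ℝ)..T, c i t = 0) →
      ∫ t in (0 : ℝ)..T, ‖∑ i, c i t • x i‖ ^ p.toReal ≤
        K ^ p.toReal * T ^ p.toReal * ∫ t in (0 : ℝ)..T, ‖∑ i, c' i t • x i‖ ^ p.toReal) :
    WirtingerInequality E p T K := by
  intro u v huv hu0
  obtain ⟨hv0, hu⟩ := huv.ae_eq_centered_primitive hp1.le hT hu0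
  rw [integral_norm_rpow_le_iff hp1 hp hT hK huv.memLp huv.memLp_deriv, eLpNorm_congr_ae hu]
  obtain ⟨A, hA, hbd⟩ := exists_eLpNorm_centered_primitive_le E hp1.le hT
  set μ := volume.restrict (Ioo 0 T) with hμ
  set B := ENNReal.ofReal (K * T) with hB
  have hvc : centered T v = v := by funext t; simp [centered, hv0]
  have hii : ∀ {z : ℝ → E}, MemLp z p μ → IntervalIntegrable z volume 0 T := fun hz =>
    intervalIntegrable_of_integrable_Ioo hT.le (hz.integrable hp1.le)
  refine ENNReal.le_of_forall_pos_le_add fun δ hδ _ => ?_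
  obtain ⟨ε, hε0, hε⟩ := ENNReal.exists_pos_mul_lt (a := A * A * A + B * A) (b := (δ : ℝ≥0∞))
    (by finiteness) (by exact_mod_cast hδ.ne')
  obtain ⟨g, hgε, ι, _, ψ, x, hψ, hg⟩ := exists_sum_smul_eLpNorm_sub_le hp huv.memLp_deriv hε0.ne'
  have hgc : Continuous g := by rw [hg]; fun_prop
  have hgm : MemLp g p μ := memLp_of_continuous hgc.continuousOn
  have hgcc := continuous_centered (T := T) hgc
  have hgcm : MemLp (centered T g) p μ := memLp_centered hgm
  have hvm := huv.memLp_deriv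
  -- the inequality for the approximation
  have hψc : ∀ i, Continuous (centered T (ψ i)) := fun i => continuous_centered (hψ i)
  have hsum := h ι x (fun i => centered T (primitive (centered T (ψ i)))) (fun i => centered T (ψ i))
    (fun i t => (intervalIntegral.integral_hasDerivAt_right ((hψc i).intervalIntegrable _ _)
      ((hψc i).stronglyMeasurableAtFilter _ _) (hψc i).continuousAt).sub_const _)
    hψc (fun i => by
      have := integral_centered hT ((hψ i).intervalIntegrable 0 T)
      rw [centered, centered, primitive, primitive, this, intervalIntegral.integral_same])
    (fun i => integral_centered hT ((continuous_primitive (hψc i)).intervalIntegrable 0 T))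
  have hcg : centered T g = fun t => ∑ i, centered T (ψ i) t • x i := by
    rw [hg, centered_sum T hψ]
  have hJg : centered T (primitive (centered T g)) =
      fun t => ∑ i, centered T (primitive (centered T (ψ i))) t • x i := by
    rw [hcg, primitive_sum hψc, centered_sum T fun i => continuous_primitive (hψc i)]
  have hg2 : eLpNorm (centered T (primitive (centered T g))) p μ ≤ B * eLpNorm (centered T g) p μ := by
    rw [hJg, hcg]
    rw [hcg] at hgcm
    refine (integral_norm_rpow_le_iff hp1 hp hT hK (memLp_of_continuous ?_) hgcm).1 hsum
    rw [← hJg]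
    exact (continuous_centered (continuous_primitive hgcc)).continuousOn
  -- comparison with `v`
  have e1 : centered T (v - g) = v - centered T g := by
    conv_rhs => rw [← hvc]
    funext t
    simp only [centered, Pi.sub_apply]
    rw [intervalIntegral.integral_sub (hii hvm) (hii hgm), smul_sub]
    abel
  have e2 : centered T (primitive v) =ᵐ[μ] centered T (primitive (v - centered T g)) +
      centered T (primitive (centered T g)) := by
    have e3 : ∀ t ∈ Icc 0 T,
        primitive (v - centered T g) t = primitive v t - primitive (centered T g) t := by
      intro t ht
      exact intervalIntegral.integral_sub
        (intervalIntegrable_of_mem_Icc (hii hvm) (left_mem_Icc.2 hT.le) ht)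
        (intervalIntegrable_of_mem_Icc (hii hgcm) (left_mem_Icc.2 hT.le) ht)
    refine (ae_restrict_iff' measurableSet_Ioo).2 (ae_of_all _ fun t ht => ?_)
    simp only [centered, Pi.add_apply]
    rw [e3 t (Ioo_subset_Icc_self ht), intervalIntegral.integral_congr (g := fun t =>
      primitive v t - primitive (centered T g) t) (fun t ht => e3 t (uIcc_of_le hT.le ▸ ht)),
      intervalIntegral.integral_sub (hii (memLp_primitive hT.le (hii hvm)))
      (hii (memLp_primitive hT.le (hii hgcm))), smul_sub]
    abel
  have hdm : MemLp (v - centered T g) p μ := hvm.sub hgcm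
  have hpm := memLp_primitive (p := p) hT.le (hii hdm)
  have hd : eLpNorm (v - centered T g) p μ ≤ A * ε := by
    rw [← e1]
    exact (hbd _ (hvm.sub hgm)).1.trans (by gcongr)
  have hcgv : eLpNorm (centered T g) p μ ≤ eLpNorm v p μ + A * ε := by
    have : centered T g = v - (v - centered T g) := by abel
    rw [this]
    exact (eLpNorm_sub_le hvm.1 hdm.1 hp1.le).trans (by gcongr)
  rw [eLpNorm_congr_ae e2]
  calc _ ≤ eLpNorm (centered T (primitive (v - centered T g))) p μ +
        eLpNorm (centered T (primitive (centered T g))) p μ :=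
          eLpNorm_add_le (memLp_centered hpm).1
            (memLp_centered (memLp_primitive (p := p) hT.le (hii hgcm))).1 hp1.le
    _ ≤ A * (A * (A * ε)) + B * (eLpNorm v p μ + A * ε) := by
          refine add_le_add ((hbd _ hpm).1.trans ?_) (hg2.trans (by gcongr))
          gcongr
          exact (hbd _ hdm).2.trans (by gcongr)
    _ = B * eLpNorm v p μ + ε * (A * A * A + B * A) := by ring
    _ ≤ B * eLpNorm v p μ + δ := by gcongr

end Density

/-! ### The inequality in `ℓ^p` and `L^p` -/

section LpSpaces

/-- The scalar inequality for a linear combination of continuously differentiable functions. -/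
theorem integral_abs_sum_rpow_le {p T : ℝ} (hp : 1 < p) (hT : 0 < T) {ι : Type*} [Fintype ι]
    {c c' : ι → ℝ → ℝ} (hd : ∀ i t, HasDerivAt (c i) (c' i t) t) (hc' : ∀ i, Continuous (c' i))
    (hper : ∀ i, c i 0 = c i T) (hmean : ∀ i, ∫ t in (0 : ℝ)..T, c i t = 0) (a : ι → ℝ) :
    ∫ t in (0 : ℝ)..T, |∑ i, c i t * a i| ^ p ≤
      wirtingerConst p ^ p * T ^ p * ∫ t in (0 : ℝ)..T, |∑ i, c' i t * a i| ^ p := by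
  have hcc : ∀ i, Continuous (c i) := fun i =>
    continuous_iff_continuousAt.2 fun t => (hd i t).continuousAt
  rw [wirtingerConst_rpow_mul hp hT]
  refine integral_abs_rpow_le_of_hasDerivAt hp hT
    (fun t => HasDerivAt.fun_sum fun i _ => (hd i t).mul_const (a i)) (by fun_prop)
    (by simp [hper]) ?_
  have hi : ∀ i ∈ Finset.univ, IntervalIntegrable (fun t => c i t * a i) volume 0 T := fun i _ =>
    ((hcc i).mul continuous_const).intervalIntegrable 0 T
  rw [intervalIntegral.integral_finsetSum hi]
  simp [intervalIntegral.integral_mul_const, hmean]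

theorem wirtingerConst_nonneg {p : ℝ} (hp : 1 < p) : 0 ≤ wirtingerConst p := by
  have h1 : 0 ≤ p - 1 := by linarith
  have h2 := (quarterPeriod_pos hp).le
  rw [wirtingerConst, integral_beta_eq hp]
  positivity

theorem one_lt_toReal {p : ℝ≥0∞} (hp1 : 1 < p) (hp : p ≠ ⊤) : 1 < p.toReal := by
  simpa using (ENNReal.toReal_lt_toReal ENNReal.one_ne_top hp).2 hp1

theorem wirtingerInequality_piLp {p : ℝ≥0∞} [Fact (1 ≤ p)] (hp1 : 1 < p) (hp : p ≠ ⊤) {T : ℝ}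
    (hT : 0 < T) (κ : Type*) [Fintype κ] :
    WirtingerInequality (PiLp p (fun _ : κ => ℝ)) p T (wirtingerConst p.toReal) := by
  have hq := one_lt_toReal hp1 hp
  refine wirtingerInequality_of_sum_smul hp1 hp hT (wirtingerConst_nonneg hq) ?_
  intro ι _ x c c' hd hc' hper hmean
  have hcc : ∀ i, Continuous (c i) := fun i =>
    continuous_iff_continuousAt.2 fun t => (hd i t).continuousAt
  have key : ∀ b : ι → ℝ → ℝ, (∀ i, Continuous (b i)) →
      ∫ t in (0 : ℝ)..T, ‖∑ i, b i t • x i‖ ^ p.toReal =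
        ∑ j, ∫ t in (0 : ℝ)..T, |∑ i, b i t * x i j| ^ p.toReal := by
    intro b hb
    have hi : ∀ j ∈ Finset.univ, IntervalIntegrable (fun t => |∑ i, b i t * x i j| ^ p.toReal)
        volume 0 T := fun j _ => by
      refine Continuous.intervalIntegrable (Continuous.rpow_const (by fun_prop) fun _ =>
        Or.inr (by linarith)) 0 T
    rw [← intervalIntegral.integral_finsetSum hi]
    refine intervalIntegral.integral_congr fun t _ => ?_
    simp only
    rw [PiLp.norm_eq_sum (by linarith), ← Real.rpow_mul (by positivity),
      one_div_mul_cancel (by linarith), Real.rpow_one]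
    simp
  rw [key c hcc, key c' hc', Finset.mul_sum]
  exact Finset.sum_le_sum fun j _ => integral_abs_sum_rpow_le hq hT hd hc' hper hmean _

theorem Lp_norm_rpow_eq {M : Type*} [MeasurableSpace M] {μ : Measure M} {p : ℝ≥0∞} (hp1 : 1 < p)
    (hp : p ≠ ⊤) (f : Lp ℝ p μ) : ‖f‖ ^ p.toReal = ∫ ξ, |f ξ| ^ p.toReal ∂μ := by
  have hp0 : p ≠ 0 := (zero_lt_one.trans hp1).ne'
  have hq := one_lt_toReal hp1 hp
  have h0 : 0 ≤ ∫ ξ, ‖f ξ‖ ^ p.toReal ∂μ := integral_nonneg fun ξ => by positivity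
  rw [Lp.norm_def, (Lp.memLp f).eLpNorm_eq_integral_rpow_norm hp0 hp,
    ENNReal.toReal_ofReal (by positivity), Real.rpow_inv_rpow h0 (by linarith)]
  rfl

/-- The inequality in `L^p(M, μ)` follows from the scalar one by integrating over `M`. The measure
need not be `σ`-finite, but finitely many `L^p` functions live on a `σ`-finite set. -/
theorem wirtingerInequality_Lp {p : ℝ≥0∞} [Fact (1 ≤ p)] (hp1 : 1 < p) (hp : p ≠ ⊤) {T : ℝ}
    (hT : 0 < T) {M : Type*} [MeasurableSpace M] (μ : Measure M) :
    WirtingerInequality (Lp ℝ p μ) p T (wirtingerConst p.toReal) := by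
  have hq := one_lt_toReal hp1 hp
  have hp0 : p ≠ 0 := (zero_lt_one.trans hp1).ne'
  refine wirtingerInequality_of_sum_smul hp1 hp hT (wirtingerConst_nonneg hq) ?_
  intro ι _ x c c' hd hc' hper hmean
  have hcc : ∀ i, Continuous (c i) := fun i =>
    continuous_iff_continuousAt.2 fun t => (hd i t).continuousAt
  have hxm : ∀ i, StronglyMeasurable (x i) := fun i => Lp.stronglyMeasurable (x i)
  set G : M → ℝ := fun ξ => ∑ i, |x i ξ| with hG
  have hGm : StronglyMeasurable G :=
    (Finset.measurable_fun_sum _ fun i _ => (hxm i).measurable.abs).stronglyMeasurable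
  have hGp : MemLp G p μ := memLp_finsetSum _ fun i _ => (Lp.memLp (x i)).norm
  obtain ⟨S, hS, hS0, hSσ⟩ := (hGp.finStronglyMeasurable_of_stronglyMeasurable hGm hp0
    hp).exists_set_sigmaFinite
  have hx0 : ∀ i, ∀ ξ, ξ ∉ S → x i ξ = 0 := fun i ξ hξ => by
    have := (Finset.sum_eq_zero_iff_of_nonneg fun i _ => abs_nonneg (x i ξ)).1 (hS0 ξ hξ) i
      (Finset.mem_univ i)
    simpa using this
  have hGi : Integrable (fun ξ => G ξ ^ p.toReal) (μ.restrict S) := by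
    refine ((hGp.integrable_norm_rpow hp0 hp).restrict (s := S)).congr (ae_of_all _ fun ξ => ?_)
    simp only
    rw [Real.norm_of_nonneg (Finset.sum_nonneg fun i _ => abs_nonneg _)]
  have key : ∀ b : ι → ℝ → ℝ, (∀ i, Continuous (b i)) →
      Integrable (fun ξ => ∫ t in (0 : ℝ)..T, |∑ i, b i t * x i ξ| ^ p.toReal) (μ.restrict S) ∧
      ∫ t in (0 : ℝ)..T, ‖∑ i, b i t • x i‖ ^ p.toReal =
        ∫ ξ in S, (∫ t in (0 : ℝ)..T, |∑ i, b i t * x i ξ| ^ p.toReal) ∂μ := by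
    intro b hb
    have hnorm : ∀ t, ‖∑ i, b i t • x i‖ ^ p.toReal =
        ∫ ξ in S, |∑ i, b i t * x i ξ| ^ p.toReal ∂μ := by
      intro t
      rw [Lp_norm_rpow_eq hp1 hp, setIntegral_eq_integral_of_forall_compl_eq_zero]
      · have h1 := Lp.coeFn_fun_finsetSum Finset.univ fun i => b i t • x i
        have h2 : ∀ᵐ ξ ∂μ, ∀ i, (b i t • x i : Lp ℝ p μ) ξ = b i t * x i ξ :=
          ae_all_iff.2 fun i => Lp.coeFn_smul (b i t) (x i)
        refine integral_congr_ae ?_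
        filter_upwards [h1, h2] with ξ h3 h4
        rw [h3]
        simp_rw [h4]
      · intro ξ hξ
        have : p.toReal ≠ 0 := by linarith
        simp [hx0 _ ξ hξ, this]
    have hbC : ∀ i, ∃ C, ∀ t ∈ Icc 0 T, |b i t| ≤ C := fun i =>
      isCompact_Icc.exists_bound_of_continuousOn (hb i).continuousOn
    choose C hC using hbC
    set D := ∑ i, |C i| with hD
    have hle : ∀ t ∈ Ioo 0 T, ∀ ξ, |∑ i, b i t * x i ξ| ≤ D * G ξ := by
      intro t ht ξ
      refine (Finset.abs_sum_le_sum_abs _ _).trans ?_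
      rw [hG, Finset.mul_sum]
      refine Finset.sum_le_sum fun i _ => ?_
      rw [abs_mul]
      refine mul_le_mul_of_nonneg_right ?_ (abs_nonneg _)
      exact ((hC i t (Ioo_subset_Icc_self ht)).trans (le_abs_self _)).trans
        (Finset.single_le_sum (f := fun i => |C i|) (fun j _ => abs_nonneg _) (Finset.mem_univ i))
    have hint : Integrable (Function.uncurry fun (t : ℝ) ξ => |∑ i, b i t * x i ξ| ^ p.toReal)
        ((volume.restrict (Ioo 0 T)).prod (μ.restrict S)) := by
      refine ((hGi.comp_snd (volume.restrict (Ioo 0 T))).const_mul (D ^ p.toReal)).mono' ?_ ?_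
      · refine Measurable.aestronglyMeasurable (Measurable.pow_const (Measurable.abs ?_) _)
        exact Finset.measurable_fun_sum _ fun i _ => ((hb i).measurable.comp measurable_fst).mul
          ((hxm i).measurable.comp measurable_snd)
      · have : ∀ᵐ z ∂((volume.restrict (Ioo 0 T)).prod (μ.restrict S)), z.1 ∈ Ioo 0 T :=
          Measure.quasiMeasurePreserving_fst.ae (ae_restrict_mem measurableSet_Ioo)
        refine this.mono fun z hz => ?_
        have hG0 : 0 ≤ G z.2 := Finset.sum_nonneg fun i _ => abs_nonneg _
        rw [← Real.mul_rpow (Finset.sum_nonneg fun i _ => abs_nonneg _) hG0]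
        simp only [Function.uncurry]
        rw [Real.norm_of_nonneg (by positivity)]
        exact Real.rpow_le_rpow (abs_nonneg _) (hle z.1 hz z.2) (by linarith)
    constructor
    · simpa only [integral_Ioo_eq_intervalIntegral hT.le, Function.uncurry] using
        hint.integral_prod_right
    · simp_rw [hnorm, ← integral_Ioo_eq_intervalIntegral hT.le]
      exact integral_integral_swap hint
  rw [(key c hcc).2, (key c' hc').2, ← integral_const_mul]
  exact integral_mono (key c hcc).1 ((key c' hc').1.const_mul _) fun ξ =>
    integral_abs_sum_rpow_le hq hT hd hc' hper hmean _

end LpSpaces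

/-! ### The `p`-sine function -/

section PSine

variable {p : ℝ} (hp : 1 < p)
include hp

theorem continuous_abs_rpow : Continuous fun x : ℝ => |x| ^ p :=
  continuous_abs.rpow_const fun _ => Or.inr (by linarith)

theorem one_sub_abs_rpow_pos {s : ℝ} (hs : |s| < 1) : 0 < 1 - |s| ^ p := by
  have := Real.rpow_lt_one (abs_nonneg s) hs (by linarith : 0 < p)
  linarith

/-- The `p`-sine function, defined as the inverse of the primitive of `(1 - |s|^p)^{-1/p}`. To obtain
a homeomorphism of `ℝ`, the integrand is replaced by `1` outside `(-1, 1)`. -/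
theorem exists_pSine : ∃ S : ℝ → ℝ, Continuous S ∧ (∀ τ, S (-τ) = -S τ) ∧
    S (quarterPeriod p) = 1 ∧ ∀ τ ∈ Ioo (-quarterPeriod p) (quarterPeriod p),
      |S τ| < 1 ∧ HasDerivAt S ((1 - |S τ| ^ p) ^ (1 / p)) τ := by
  set k : ℝ → ℝ := fun s => (1 - |s| ^ p) ^ (-1 / p) with hk
  set h : ℝ → ℝ := fun s => if |s| < 1 then k s else 1 with hh
  have hkm : Measurable k := (measurable_const.sub
    (continuous_abs_rpow hp).measurable).pow_const _
  have hhm : Measurable h := Measurable.ite (measurableSet_lt continuous_abs.measurable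
    measurable_const) hkm measurable_const
  have hh1 : ∀ s, 1 ≤ h s := by
    intro s
    simp only [hh]
    split_ifs with hs
    · refine Real.one_le_rpow_of_pos_of_le_one_of_nonpos (one_sub_abs_rpow_pos hp hs) ?_ ?_
      · have := Real.rpow_nonneg (abs_nonneg s) p
        linarith
      · rw [neg_one_div_eq]
        have : 0 < 1 / p := by positivity
        linarith
    · exact le_rfl
  have heven : ∀ s, h (-s) = h s := fun s => by simp [hh, hk]
  have hi01 : IntervalIntegrable h volume 0 1 := by
    refine intervalIntegrable_of_le_one_sub_rpow hp hhm 1 fun s hs => ?_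
    have hs1 : |s| < 1 := by rw [abs_of_pos hs.1]; exact hs.2
    rw [abs_of_nonneg (zero_le_one.trans (hh1 s)), one_mul]
    simp only [hh, hk, if_pos hs1, abs_of_pos hs.1]
    rw [← profile_one]
    exact profile_rpow_le hp one_pos hs
  have hi1 : ∀ b, 1 ≤ b → IntervalIntegrable h volume 1 b := by
    intro b hb
    refine (intervalIntegrable_const (c := (1 : ℝ))).congr_uIoo fun s hs => ?_
    rw [uIoo_of_le hb] at hs
    have : ¬ |s| < 1 := not_lt.2 (hs.1.le.trans (le_abs_self s))
    simp [hh, this]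
  have hipos : ∀ b, 0 ≤ b → IntervalIntegrable h volume 0 b := by
    intro b hb
    refine (hi01.trans (hi1 _ (le_max_right b 1))).mono_set ?_
    rw [uIcc_of_le hb, uIcc_of_le (hb.trans (le_max_left _ _))]
    exact Icc_subset_Icc_right (le_max_left _ _)
  have hi0 : ∀ b, IntervalIntegrable h volume 0 b := by
    intro b
    rcases le_total 0 b with hb | hb
    · exact hipos b hb
    · have : IntervalIntegrable (fun s => h (0 - s)) volume (0 - 0) (0 - -b) :=
        (hipos (-b) (by linarith)).comp_sub_left 0
      simpa [heven] using this
  have hi : ∀ a b, IntervalIntegrable h volume a b := fun a b => (hi0 a).symm.trans (hi0 b)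
  set g : ℝ → ℝ := fun y => ∫ s in (0 : ℝ)..y, h s with hg
  -- the primitive `g` expands distances because the integrand is at least `1`
  have hgsub : ∀ x y, x ≤ y → y - x ≤ g y - g x := by
    intro x y hxy
    simp only [hg]
    rw [intervalIntegral.integral_interval_sub_left (hi0 y) (hi0 x)]
    have := intervalIntegral.integral_mono_on hxy intervalIntegrable_const (hi x y)
      (fun s _ => hh1 s)
    simpa using this
  have hgmono : StrictMono g := fun x y hxy => by
    have := hgsub x y hxy.le
    linarith
  have hgc : Continuous g := intervalIntegral.continuous_primitive hi 0
  have hg0 : g 0 = 0 := intervalIntegral.integral_same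
  have hgsurj : Function.Surjective g := by
    refine hgc.surjective ?_ ?_
    · refine Filter.tendsto_atTop_mono' _ ?_ Filter.tendsto_id
      filter_upwards [Filter.eventually_ge_atTop 0] with y hy
      have := hgsub 0 y hy
      simp only [id]
      linarith
    · refine Filter.tendsto_atBot_mono' _ ?_ Filter.tendsto_id
      filter_upwards [Filter.eventually_le_atBot 0] with y hy
      have := hgsub y 0 hy
      simp only [id]
      linarith
  have hgodd : ∀ y, g (-y) = -g y := by
    intro y
    have := intervalIntegral.integral_comp_neg (a := 0) (b := y) h
    simp only [heven, neg_zero] at this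
    simp only [hg]
    rw [this, intervalIntegral.integral_symm]
  have hg1 : g 1 = quarterPeriod p := by
    refine intervalIntegral.integral_congr_Ioo_of_le zero_le_one fun s hs => ?_
    have hs1 : |s| < 1 := by rw [abs_of_pos hs.1]; exact hs.2
    simp only [hh, hk, if_pos hs1, abs_of_pos hs.1]
  set e := hgmono.orderIsoOfSurjective g hgsurj with he
  have hge : ∀ τ, g (e.symm τ) = τ := fun τ => e.apply_symm_apply τ
  refine ⟨e.symm, e.symm.continuous, fun τ => ?_, ?_, fun τ hτ => ?_⟩
  · exact hgmono.injective (by rw [hge, hgodd, hge])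
  · exact hgmono.injective (by rw [hge, hg1])
  · have habs : |e.symm τ| < 1 := by
      rw [abs_lt]
      constructor
      · rw [← hgmono.lt_iff_lt, hgodd, hg1, hge]; exact hτ.1
      · rw [← hgmono.lt_iff_lt, hg1, hge]; exact hτ.2
    refine ⟨habs, ?_⟩
    have hpos := one_sub_abs_rpow_pos hp habs
    have hev : h =ᶠ[nhds (e.symm τ)] k := by
      filter_upwards [(isOpen_lt continuous_abs continuous_const).mem_nhds habs] with s hs
      simp only [hh]
      exact if_pos hs
    have hkc : ContinuousAt k (e.symm τ) :=
      (continuous_const.sub (continuous_abs_rpow hp)).continuousAt.rpow_const (Or.inl hpos.ne')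
    have hder : HasDerivAt g (k (e.symm τ)) (e.symm τ) := by
      have := intervalIntegral.integral_hasDerivAt_right (hi0 (e.symm τ))
        hhm.stronglyMeasurable.stronglyMeasurableAtFilter (hkc.congr hev.symm)
      rwa [hev.eq_of_nhds] at this
    have hk0 : 0 < k (e.symm τ) := Real.rpow_pos_of_pos hpos _
    have := hder.of_local_left_inverse (f := g) e.symm.continuous.continuousAt hk0.ne'
      (Filter.Eventually.of_forall hge)
    refine this.congr_deriv ?_
    simp only [hk]
    rw [neg_one_div_eq, Real.rpow_neg hpos.le, inv_inv]

/-- Equality of the two energies of the `p`-sine function, up to the factor `p - 1`. -/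
theorem integral_one_sub_abs_rpow {L : ℝ} (hL : 0 ≤ L) {S : ℝ → ℝ} (hS : Continuous S)
    (hodd : ∀ τ, S (-τ) = -S τ) (hSL : S L = 1)
    (hd : ∀ τ ∈ Ioo (-L) L, |S τ| < 1 ∧ HasDerivAt S ((1 - |S τ| ^ p) ^ (1 / p)) τ) :
    ∫ τ in (-L)..L, (1 - |S τ| ^ p) = (p - 1) * ∫ τ in (-L)..L, |S τ| ^ p := by
  have hr := one_sub_inv_pos hp
  have hc : Continuous fun τ => |S τ| ^ p := (continuous_abs_rpow hp).comp hS
  have hF : Continuous fun τ => S τ * (1 - |S τ| ^ p) ^ (1 - 1 / p) :=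
    hS.mul ((continuous_const.sub hc).rpow_const fun _ => Or.inr hr.le)
  have hi : Continuous fun τ => (1 - |S τ| ^ p) - (p - 1) * |S τ| ^ p := by fun_prop
  have hftc := intervalIntegral.integral_eq_sub_of_hasDerivAt_of_le (by linarith : -L ≤ L)
    hF.continuousOn (f' := fun τ => (1 - |S τ| ^ p) - (p - 1) * |S τ| ^ p) (fun τ hτ => by
      obtain ⟨h1, h2⟩ := hd τ hτ
      have hpos := one_sub_abs_rpow_pos hp h1
      have h3 := (((hasDerivAt_abs_rpow (S τ) hp).comp τ h2).const_sub 1).rpow_const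
        (p := 1 - 1 / p) (Or.inl hpos.ne')
      refine (h2.mul h3).congr_deriv ?_
      have e1 : (1 - |S τ| ^ p) ^ (1 / p) * (1 - |S τ| ^ p) ^ (1 - 1 / p) = 1 - |S τ| ^ p := by
        rw [← Real.rpow_add hpos]; simp
      have e2 : (1 - |S τ| ^ p) ^ (1 / p) * (1 - |S τ| ^ p) ^ (1 - 1 / p - 1) = 1 := by
        rw [← Real.rpow_add hpos]; simp
      have e3 : |S τ| ^ (p - 2) * (S τ * S τ) = |S τ| ^ p := by
        rcases eq_or_ne (S τ) 0 with h0 | h0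
        · have : p ≠ 0 := by linarith
          simp [h0, this]
        · rw [← abs_mul_abs_self, ← pow_two, ← Real.rpow_natCast, ← Real.rpow_add (abs_pos.2 h0)]
          congr 1
          push_cast
          ring
      have e4 : p * (1 - 1 / p) = p - 1 := by
        field_simp
      simp only [Function.comp]
      linear_combination e1 - p * (1 - 1 / p) * (|S τ| ^ (p - 2) * (S τ * S τ)) * e2 -
        p * (1 - 1 / p) * e3 - |S τ| ^ p * e4) (hi.intervalIntegrable _ _)
  have hi1 : IntervalIntegrable (fun τ => 1 - |S τ| ^ p) volume (-L) L :=
    (continuous_const.sub hc).intervalIntegrable _ _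
  have hi2 : IntervalIntegrable (fun τ => (p - 1) * |S τ| ^ p) volume (-L) L :=
    (continuous_const.mul hc).intervalIntegrable _ _
  rw [intervalIntegral.integral_sub hi1 hi2, intervalIntegral.integral_const_mul] at hftc
  rw [← sub_eq_zero, hftc, hodd, hSL, abs_neg, abs_one, Real.one_rpow, sub_self,
    Real.zero_rpow hr.ne']
  ring

end PSine

/-! ### Optimality of the constant -/

section Optimality

/-- Integration over one period of a function of the triangle wave. -/
theorem integral_comp_triangle {T L : ℝ} (hT : 0 < T) (hL : 0 < L) {F : ℝ → ℝ}
    (hF : Continuous F) :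
    ∫ t in (0 : ℝ)..T, F (4 * L / T * (T / 4 - |t - T / 2|)) =
      2 * (4 * L / T)⁻¹ * ∫ τ in (-L)..L, F τ := by
  have hκ : 4 * L / T ≠ 0 := by positivity
  have hc : Continuous fun t => F (4 * L / T * (T / 4 - |t - T / 2|)) := by fun_prop
  rw [← intervalIntegral.integral_add_adjacent_intervals (hc.intervalIntegrable 0 (T / 2))
    (hc.intervalIntegrable (T / 2) T)]
  have h1 : ∫ t in (0 : ℝ)..(T / 2), F (4 * L / T * (T / 4 - |t - T / 2|)) =
      ∫ t in (0 : ℝ)..(T / 2), F (4 * L / T * t - L) := by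
    refine intervalIntegral.integral_congr fun t ht => ?_
    rw [uIcc_of_le (by linarith)] at ht
    rw [abs_of_nonpos (by linarith [ht.2])]
    congr 1
    field_simp
    ring
  have h2 : ∫ t in (T / 2)..T, F (4 * L / T * (T / 4 - |t - T / 2|)) =
      ∫ t in (T / 2)..T, F (3 * L - 4 * L / T * t) := by
    refine intervalIntegral.integral_congr fun t ht => ?_
    rw [uIcc_of_le (by linarith)] at ht
    rw [abs_of_nonneg (by linarith [ht.1])]
    congr 1
    field_simp
    ring
  rw [h1, h2, intervalIntegral.integral_comp_mul_sub F hκ, intervalIntegral.integral_comp_sub_mul F hκ]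
  have a1 : 4 * L / T * 0 - L = -L := by ring
  have a2 : 4 * L / T * (T / 2) - L = L := by field_simp; ring
  have a3 : 3 * L - 4 * L / T * T = -L := by field_simp; ring
  have a4 : 3 * L - 4 * L / T * (T / 2) = L := by field_simp; ring
  rw [a1, a2, a3, a4, smul_eq_mul]
  ring

/-- Multiples of a nonzero vector by the `p`-sine function of a triangle wave show that the constant
cannot be improved. -/
theorem wirtingerConst_le_of_wirtingerInequality {E : Type*} [NormedAddCommGroup E]
    [NormedSpace ℝ E] [CompleteSpace E] {p : ℝ≥0∞} (hp1 : 1 < p) (hp : p ≠ ⊤) {T : ℝ} (hT : 0 < T)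
    {x : E} (hx : x ≠ 0) {K : ℝ} (hK : 0 ≤ K) (h : WirtingerInequality E p T K) :
    wirtingerConst p.toReal ≤ K := by
  have hq := one_lt_toReal hp1 hp
  have hC := wirtingerConst_rpow_mul hq hT
  have hC0 := wirtingerConst_nonneg hq
  set q := p.toReal with hq_def
  obtain ⟨S, hS, hodd, hSL, hd⟩ := exists_pSine hq
  have hL := quarterPeriod_pos hq
  set L := quarterPeriod q with hL_def
  set κ := 4 * L / T with hκ_def
  have hκ : 0 < κ := by positivity
  have hκT : κ * (T / 4) = L := by rw [hκ_def]; field_simp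
  set τ : ℝ → ℝ := fun t => κ * (T / 4 - |t - T / 2|) with hτ
  have hτc : Continuous τ := by fun_prop
  have hτmem : ∀ t ∈ Ioo 0 T, t ≠ T / 2 → τ t ∈ Ioo (-L) L := by
    intro t ht hne
    have h1 : 0 < |t - T / 2| := abs_pos.2 (sub_ne_zero.2 hne)
    have h2 : |t - T / 2| < T / 2 := abs_lt.2 ⟨by linarith [ht.1], by linarith [ht.2]⟩
    rw [← hκT]
    constructor <;> simp only [hτ] <;> nlinarith
  have hSabs : ∀ σ ∈ Icc (-L) L, |S σ| ≤ 1 := by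
    intro σ hσ
    rcases hσ.1.eq_or_lt with h1 | h1
    · rw [← h1, hodd, hSL]; simp
    rcases hσ.2.eq_or_lt with h2 | h2
    · rw [h2, hSL]; simp
    exact (hd σ ⟨h1, h2⟩).1.le
  set u : ℝ → ℝ := fun t => S (τ t) with hu
  have huc : Continuous u := hS.comp hτc
  have huc' : Continuous fun t => (1 - |u t| ^ q) ^ (1 / q) :=
    (continuous_const.sub ((continuous_abs_rpow hq).comp huc)).rpow_const
      fun _ => Or.inr (by positivity)
  set v : ℝ → ℝ := fun t => (if t < T / 2 then κ else -κ) * (1 - |u t| ^ q) ^ (1 / q) with hv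
  have hvm : Measurable v :=
    (Measurable.ite measurableSet_Iio measurable_const measurable_const).mul huc'.measurable
  have hsgn : ∀ t, |if t < T / 2 then κ else -κ| = κ := fun t => by
    split_ifs
    · exact abs_of_pos hκ
    · rw [abs_neg, abs_of_pos hκ]
  have hτmem' : ∀ t ∈ Icc 0 T, τ t ∈ Icc (-L) L := by
    intro t ht
    have h1 := abs_nonneg (t - T / 2)
    have h2 : |t - T / 2| ≤ T / 2 := abs_le.2 ⟨by linarith [ht.1], by linarith [ht.2]⟩
    rw [← hκT]
    constructor <;> simp only [hτ] <;> nlinarith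
  have hu1 : ∀ t ∈ Icc 0 T, 0 ≤ 1 - |u t| ^ q := fun t ht => by
    have := Real.rpow_le_one (abs_nonneg (u t)) (hSabs _ (hτmem' t ht)) (by linarith : 0 ≤ q)
    linarith
  have hvabs : ∀ t ∈ Icc 0 T, |v t| = κ * (1 - |u t| ^ q) ^ (1 / q) := fun t ht => by
    simp only [hv]
    rw [abs_mul, hsgn, abs_of_nonneg (Real.rpow_nonneg (hu1 t ht) _)]
  have hvle : ∀ t ∈ Icc 0 T, |v t| ≤ κ := fun t ht => by
    rw [hvabs t ht]
    have h1 : (1 - |u t| ^ q) ^ (1 / q) ≤ 1 := by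
      refine Real.rpow_le_one (hu1 t ht) ?_ (by positivity)
      have := Real.rpow_nonneg (abs_nonneg (u t)) q
      linarith
    nlinarith
  have hderiv : ∀ t ∈ Ioo 0 T, t ≠ T / 2 → HasDerivAt u (v t) t := by
    intro t ht hne
    have h1 := (hd (τ t) (hτmem t ht hne)).2
    have h2 : HasDerivAt τ (if t < T / 2 then κ else -κ) t := by
      rcases lt_or_gt_of_ne hne with hlt | hgt
      · rw [if_pos hlt]
        have h3 : HasDerivAt (fun t => κ * (T / 4 - (T / 2 - t))) κ t := by
          have := (((hasDerivAt_id t).const_sub (T / 2)).const_sub (T / 4)).const_mul κ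
          simpa using this
        refine h3.congr_of_eventuallyEq ?_
        filter_upwards [Iio_mem_nhds hlt] with s hs
        simp only [hτ]
        rw [abs_of_neg (sub_neg.2 hs), neg_sub]
      · rw [if_neg (not_lt.2 hgt.le)]
        have h3 : HasDerivAt (fun t => κ * (T / 4 - (t - T / 2))) (-κ) t := by
          have := (((hasDerivAt_id t).sub_const (T / 2)).const_sub (T / 4)).const_mul κ
          simpa using this
        refine h3.congr_of_eventuallyEq ?_
        filter_upwards [Ioi_mem_nhds hgt] with s hs
        simp only [hτ]
        rw [abs_of_pos (sub_pos.2 hs)]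
    refine (h1.comp t h2).congr_deriv ?_
    simp only [hv, hu]
    ring
  have hvmem : MemLp (fun t => v t • x) p (volume.restrict (Ioo 0 T)) := by
    refine MemLp.of_bound (hvm.aestronglyMeasurable.smul_const x) (κ * ‖x‖)
      ((ae_restrict_iff' measurableSet_Ioo).2 (ae_of_all _ fun t ht => ?_))
    rw [norm_smul]
    exact mul_le_mul_of_nonneg_right (hvle t (Ioo_subset_Icc_self ht)) (norm_nonneg _)
  have hvint : IntervalIntegrable v volume 0 T := by
    refine (intervalIntegrable_const (c := κ)).mono_fun' hvm.aestronglyMeasurable ?_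
    rw [uIoc_of_le hT.le]
    exact (ae_restrict_iff' measurableSet_Ioc).2
      (ae_of_all _ fun t ht => hvle t (Ioc_subset_Icc_self ht))
  have humem : MemLp (fun t => u t • x) p (volume.restrict (Ioo 0 T)) :=
    memLp_of_continuous (huc.smul continuous_const).continuousOn
  have hmem : MemW1pPer p T (fun t => u t • x) (fun t => v t • x) := by
    refine ⟨humem, hvmem, ⟨?_, ?_, ?_⟩, ?_⟩
    · exact IntegrableOn.locallyIntegrableOn (humem.integrable hp1.le)
    · exact IntegrableOn.locallyIntegrableOn (hvmem.integrable hp1.le)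
    · intro φ hφ _ hφs
      have hφ' : Continuous (deriv φ) := hφ.continuous_deriv (by simp)
      have h0 : φ 0 = 0 := image_eq_zero_of_notMem_tsupport fun h => lt_irrefl _ (hφs h).1
      have h1 : φ T = 0 := image_eq_zero_of_notMem_tsupport fun h => lt_irrefl _ (hφs h).2
      have hi1 : IntervalIntegrable (fun t => deriv φ t * u t) volume 0 T :=
        (hφ'.mul huc).intervalIntegrable _ _
      have hi2 : IntervalIntegrable (fun t => φ t * v t) volume 0 T :=
        hvint.continuousOn_mul hφ.continuous.continuousOn
      have hftc := integral_eq_of_hasDerivAt_off_countable (fun t => φ t * u t)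
        (fun t => deriv φ t * u t + φ t * v t) (a := 0) (b := T) (s := {T / 2})
        (countable_singleton _) (hφ.continuous.mul huc).continuousOn (fun t ht => by
          rw [min_eq_left hT.le, max_eq_right hT.le] at ht
          exact ((hφ.differentiable (by simp)) t).hasDerivAt.mul (hderiv t ht.1 ht.2))
        (hi1.add hi2)
      rw [intervalIntegral.integral_add hi1 hi2, h0, h1, zero_mul, zero_mul, sub_zero] at hftc
      simp_rw [smul_smul]
      rw [intervalIntegral.integral_smul_const, intervalIntegral.integral_smul_const,
        eq_neg_of_add_eq_zero_left hftc, neg_smul]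
    · refine ⟨fun t => u t • x, (huc.smul continuous_const).continuousOn, Filter.EventuallyEq.rfl, ?_⟩
      have : τ 0 = τ T := by
        simp only [hτ]
        rw [zero_sub, abs_neg]
        congr 3
        ring
      simp only [hu, this]
  have hmean : ∫ t in (0 : ℝ)..T, u t • x = 0 := by
    have h1 : ∫ t in (0 : ℝ)..T, u t = 2 * κ⁻¹ * ∫ σ in (-L)..L, S σ :=
      integral_comp_triangle hT hL hS
    have h2 := intervalIntegral.integral_comp_neg (a := -L) (b := L) S
    simp only [hodd, neg_neg, intervalIntegral.integral_neg] at h2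
    rw [intervalIntegral.integral_smul_const, h1, self_eq_neg.1 h2.symm]
    simp
  have key := h _ _ hmem hmean
  have hScq : Continuous fun σ => |S σ| ^ q := (continuous_abs_rpow hq).comp hS
  set P := ∫ σ in (-L)..L, |S σ| ^ q with hP
  have hPpos : 0 < P := by
    refine intervalIntegral.integral_pos (by linarith) hScq.continuousOn
      (fun σ _ => by positivity) ⟨L, ⟨by linarith, le_rfl⟩, ?_⟩
    rw [hSL]; simp
  have hleft : ∫ t in (0 : ℝ)..T, ‖u t • x‖ ^ q = ‖x‖ ^ q * (2 * κ⁻¹ * P) := by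
    rw [← integral_comp_triangle hT hL hScq, ← intervalIntegral.integral_const_mul]
    refine intervalIntegral.integral_congr fun t _ => ?_
    rw [norm_smul, Real.mul_rpow (norm_nonneg _) (norm_nonneg _), mul_comm]
    rfl
  have hright : ∫ t in (0 : ℝ)..T, ‖v t • x‖ ^ q =
      ‖x‖ ^ q * (κ ^ q * (2 * κ⁻¹ * ((q - 1) * P))) := by
    have hF : Continuous fun σ => 1 - |S σ| ^ q := continuous_const.sub hScq
    rw [hP, ← integral_one_sub_abs_rpow hq hL.le hS hodd hSL hd, ← integral_comp_triangle hT hL hF,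
      ← intervalIntegral.integral_const_mul, ← intervalIntegral.integral_const_mul]
    refine intervalIntegral.integral_congr fun t ht => ?_
    rw [uIcc_of_le hT.le] at ht
    rw [norm_smul, Real.mul_rpow (norm_nonneg _) (norm_nonneg _), mul_comm, Real.norm_eq_abs,
      hvabs t ht, Real.mul_rpow hκ.le (Real.rpow_nonneg (hu1 t ht) _), ← Real.rpow_mul (hu1 t ht),
      one_div_mul_cancel (by linarith), Real.rpow_one]
  rw [hleft, hright] at key
  have hx0 : 0 < ‖x‖ ^ q := Real.rpow_pos_of_pos (norm_pos_iff.2 hx) q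
  have hq1 : 0 < q - 1 := by linarith
  have hκq : 0 < κ ^ q := Real.rpow_pos_of_pos hκ q
  have hTq : 0 < T ^ q := Real.rpow_pos_of_pos hT q
  have hfac : 0 < ‖x‖ ^ q * (2 * κ⁻¹ * P) := by positivity
  have h1 : 1 ≤ K ^ q * T ^ q * ((q - 1) * κ ^ q) := by
    rw [← mul_le_mul_iff_right₀ hfac]
    linarith
  have h2 : wirtingerConst q ^ q * T ^ q ≤ K ^ q * T ^ q := by
    rw [hC, inv_le_iff_one_le_mul₀ (by positivity)]
    exact h1
  exact (Real.rpow_le_rpow_iff hC0 hK (by linarith)).1 (le_of_mul_le_mul_right h2 hTq)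

end Optimality

/-! ### The inequality and its sharpness -/

theorem corollary3 (p : ℝ≥0∞) [Fact (1 ≤ p)] (hp1 : 1 < p) (hp : p ≠ ⊤) (T : ℝ) (hT : 0 < T)
    (n : ℕ) {M : Type*} [MeasurableSpace M] (μ : Measure M) :
    (WirtingerInequality (PiLp p (fun _ : Fin n => ℝ)) p T (wirtingerConst p.toReal) ∧
      (1 ≤ n → ∀ K : ℝ, 0 ≤ K → WirtingerInequality (PiLp p (fun _ : Fin n => ℝ)) p T K →
        wirtingerConst p.toReal ≤ K)) ∧
    (WirtingerInequality (Lp ℝ p μ) p T (wirtingerConst p.toReal) ∧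
      ((∃ A : Set M, MeasurableSet A ∧ 0 < μ A ∧ μ A < ⊤) →
        ∀ K : ℝ, 0 ≤ K → WirtingerInequality (Lp ℝ p μ) p T K →
          wirtingerConst p.toReal ≤ K)) := by
  refine ⟨⟨wirtingerInequality_piLp hp1 hp hT (Fin n), fun hn K hK h => ?_⟩,
    wirtingerInequality_Lp hp1 hp hT μ, ?_⟩
  · have hx : (WithLp.toLp p fun _ => 1 : PiLp p (fun _ : Fin n => ℝ)) ≠ 0 := fun h0 => by
      have := congrArg (fun y : PiLp p (fun _ : Fin n => ℝ) => y ⟨0, hn⟩) h0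
      simp at this
    exact wirtingerConst_le_of_wirtingerInequality hp1 hp hT hx hK h
  · rintro ⟨A, hA, hA0, hA1⟩ K hK h
    have hp0 : p ≠ 0 := (zero_lt_one.trans hp1).ne'
    have hx : indicatorConstLp p hA hA1.ne (1 : ℝ) ≠ 0 := by
      rw [← norm_pos_iff, norm_indicatorConstLp hp0 hp, norm_one, one_mul]
      exact Real.rpow_pos_of_pos (ENNReal.toReal_pos hA0.ne' hA1.ne) _
    exact wirtingerConst_le_of_wirtingerInequality hp1 hp hT hx hK h
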